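/- Let $n\ge 1$ be an integer. There exists a constant $c>0$, depending only on $n$, such that for every vector field $\Phi\in C(\overline{(0,1)^n};\mathbb{R}^n)\cap C^1((0,1)^n;\mathbb{R}^n)$ with $\operatorname{div}\Phi=\sum_{i=1}^n\partial_i\Phi_i=0$ in $(0,1)^n$ and every $\varphi\in C_c^\infty((0,1)^n;\mathbb{R}^n)$, $$\int_{(0,1)^n}\langle\Phi,\varphi\rangle\,dx\;\le\; c\,\|\Phi\|_{L^1((0,1)^n)}\,\|\nabla\varphi\|_{L^n((0,1)^n)}.$$ Here $\langle\cdot,\cdot\rangle$ is the Euclidean inner product on $\mathbb{R}^n$, $\nabla\varphi=(\partial_j\varphi_i)_{i,j}$ is the full gradient matrix, and the Lebesgue norms are taken with respect to the Euclidean norm on $\mathbb{R}^n$ and the Euclidean (Frobenius) norm on $\mathbb{R}^{n\times n}$. -/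

import Mathlib

open MeasureTheory
open scoped ContDiff

/-- The open unit cube `(0,1)^n` in Euclidean `n`-space. -/
def unitCube (n : ℕ) : Set (EuclideanSpace ℝ (Fin n)) :=
  {x | ∀ i, x i ∈ Set.Ioo (0 : ℝ) 1}

/-- The partial derivative `∂_j u_i (x)` of the `i`-th component of a vector field. -/
noncomputable def partialDeriv {n : ℕ} (u : EuclideanSpace ℝ (Fin n) → EuclideanSpace ℝ (Fin n))
    (i j : Fin n) (x : EuclideanSpace ℝ (Fin n)) : ℝ :=
  (fderiv ℝ u x (EuclideanSpace.single j 1)) i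

/-- The divergence `∑ i, ∂_i u_i`. -/
noncomputable def divergence {n : ℕ} (u : EuclideanSpace ℝ (Fin n) → EuclideanSpace ℝ (Fin n))
    (x : EuclideanSpace ℝ (Fin n)) : ℝ :=
  ∑ i, partialDeriv u i i x

/-- The full gradient `∇u = (∂_j u_i)_{ij}`. Its norm, as an element of
`EuclideanSpace ℝ (Fin n × Fin n)`, is the Euclidean (Frobenius) norm of the matrix. -/
noncomputable def gradMatrix {n : ℕ} (u : EuclideanSpace ℝ (Fin n) → EuclideanSpace ℝ (Fin n))
    (x : EuclideanSpace ℝ (Fin n)) : EuclideanSpace ℝ (Fin n × Fin n) :=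
  WithLp.toLp 2 fun p => partialDeriv u p.1 p.2 x

section

open scoped ENNReal

/-! Write `n = m + 1` and estimate each `∫ Φ_i φ_i` separately, slicing the cube by the hyperplanes
`x_i = t`. Let `A(t)` be the mass of the field on a slice and `B` its total mass. By Morrey's
inequality in dimension `m` with exponent `m + 1`, the slice `ψ` of `φ_i` is Hölder of order
`1/(m+1)`, with constant `K` controlled by the `L^{m+1}` norm of its gradient.

Replace `ψ` by a `C¹` function `g`, still supported in the open slice, with `|ψ - g| ≤ 3δ`, `|∇g| ≲
δ/ε` and `δ = K ε^{1/(m+1)}`. The error contributes at most `3δ A(t)`. For `g`, vanishing divergence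
turns the `t`-derivative of the flux into an integral of tangential components of the field against
`∇g`, so the flux is at most a constant times `(δ/ε) B`. The choice `ε = B/A(t)` balances the two
terms and yields `K A(t)^{m/(m+1)} B^{1/(m+1)}`
(`IsSolenoidalOnCube.exists_enorm_integral_slice_le`). Hölder's inequality in `t` then gives `B
‖∇φ_i‖_{L^n}`.

For `n = 1` the slices are points, and the bound of a function by the integral of its derivative
suffices. Most of the argument uses the sup norm on `Fin n → ℝ`; the passage to Euclidean norms
costs only factors depending on `n`. -/

/-! ### Morrey's inequality in the sup norm. -/

theorem enorm_sub_le_lintegral_fderiv {E : Type*} [NormedAddCommGroup E] [NormedSpace ℝ E]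
    {ψ : E → ℝ} (hψ : ContDiff ℝ 1 ψ) (a w : E) :
    ‖ψ a - ψ w‖ₑ ≤ ∫⁻ τ in Set.Ioo (0 : ℝ) 1, ‖fderiv ℝ ψ (a + τ • (w - a))‖ₑ * ‖w - a‖ₑ := by
  have hd : ∀ τ : ℝ, HasDerivAt (fun τ : ℝ => ψ (a + τ • (w - a)))
      (fderiv ℝ ψ (a + τ • (w - a)) (w - a)) τ := by
    intro τ
    have h1 : HasDerivAt (fun τ : ℝ => a + τ • (w - a)) (w - a) τ := by
      simpa using ((hasDerivAt_id τ).smul_const (w - a)).const_add a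
    exact ((hψ.differentiable one_ne_zero).differentiableAt.hasFDerivAt).comp_hasDerivAt τ h1
  have hc : Continuous (fun τ : ℝ => fderiv ℝ ψ (a + τ • (w - a)) (w - a)) :=
    ((hψ.continuous_fderiv one_ne_zero).comp (by fun_prop)).clm_apply continuous_const
  have h2 := intervalIntegral.integral_eq_sub_of_hasDerivAt (a := 0) (b := 1)
    (fun τ _ => hd τ) (hc.intervalIntegrable _ _)
  have h3 : ψ a - ψ w = -∫ τ in (0:ℝ)..1, fderiv ℝ ψ (a + τ • (w - a)) (w - a) := by
    rw [h2]; simp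
  rw [h3, enorm_neg, intervalIntegral.integral_of_le zero_le_one, integral_Ioc_eq_integral_Ioo]
  refine (enorm_integral_le_lintegral_enorm _).trans (lintegral_mono fun τ => ?_)
  exact ContinuousLinearMap.le_opENorm _ _

theorem lintegral_comp_add_smul_sub {m : ℕ} (a : Fin m → ℝ) {τ : ℝ} (hτ : 0 < τ)
    (f : (Fin m → ℝ) → ℝ≥0∞) :
    ∫⁻ w, f (a + τ • (w - a)) = ENNReal.ofReal ((τ ^ m)⁻¹) * ∫⁻ z, f z := by
  have h1 : ∫⁻ w, f (a + τ • (w - a)) = ∫⁻ w, f (a + τ • w) :=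
    lintegral_sub_right_eq_self (fun w => f (a + τ • w)) a
  have h2 : ∫⁻ w, f (a + τ • w) = ∫⁻ z, f (a + z) ∂(Measure.map (fun x => τ • x) volume) :=
    ((Homeomorph.smulOfNeZero τ hτ.ne').measurableEmbedding.lintegral_map
      (μ := (volume : Measure (Fin m → ℝ))) (fun z => f (a + z))).symm
  rw [h1, h2, Measure.map_addHaar_smul _ hτ.ne', lintegral_smul_measure,
    lintegral_add_left_eq_self f a, abs_of_pos (by positivity)]
  simp

/-- The integrand is the Jacobian `τ^{-m}` of a homothety raised to the power `1/(m+1)`. It is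
integrable at `0` because the exponent `m + 1` exceeds the dimension `m`. -/
theorem lintegral_Ioo_rpow_neg (m : ℕ) :
    ∫⁻ τ in Set.Ioo (0 : ℝ) 1, ENNReal.ofReal (τ ^ (-(m : ℝ) / (m + 1))) = (m + 1 : ℝ≥0∞) := by
  have hlt : -1 < -(m : ℝ) / (m + 1) := by
    rw [lt_div_iff₀ (by positivity)]; linarith
  have hint : IntervalIntegrable (fun τ : ℝ => τ ^ (-(m : ℝ) / (m + 1))) volume 0 1 :=
    intervalIntegral.intervalIntegrable_rpow' hlt
  rw [intervalIntegrable_iff_integrableOn_Ioo_of_le zero_le_one] at hint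
  rw [← ofReal_integral_eq_lintegral_ofReal hint, ← integral_Ioc_eq_integral_Ioo,
    ← intervalIntegral.integral_of_le zero_le_one, integral_rpow (Or.inl hlt)]
  · have : -(m : ℝ) / (m + 1) + 1 = 1 / (m + 1) := by field_simp; ring
    rw [this, Real.zero_rpow (by positivity)]
    simp only [Real.one_rpow, sub_zero, one_div, inv_inv]
    rw [show (m : ℝ) + 1 = ((m + 1 : ℕ) : ℝ) by push_cast; rfl, ENNReal.ofReal_natCast]; push_cast; rfl
  · filter_upwards [ae_restrict_mem measurableSet_Ioo] with τ hτ
    exact Real.rpow_nonneg hτ.1.le _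

/-- Integrate the derivative along the segments from `a`, exchange the integrals, and apply Hölder
in `w` at fixed `τ`. The homothety `w ↦ a + τ(w - a)` costs the integrable factor `τ^{-m/(m+1)}`.
Since the gradient is integrated over the whole space, `B` need not be star-shaped about `a`. -/
theorem setLIntegral_enorm_sub_le {m : ℕ} {ψ : (Fin m → ℝ) → ℝ} (hψ : ContDiff ℝ 1 ψ)
    {B : Set (Fin m → ℝ)} {a : Fin m → ℝ} {R : ℝ} (hR : ∀ w ∈ B, ‖w - a‖ ≤ R)
    (hB : MeasurableSet B) :
    ∫⁻ w in B, ‖ψ a - ψ w‖ₑ ≤ ENNReal.ofReal R * (m + 1) *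
      (volume B ^ ((m : ℝ) / (m + 1)) *
        (∫⁻ z, ‖fderiv ℝ ψ z‖ₑ ^ ((m : ℝ) + 1)) ^ (1 / ((m : ℝ) + 1))) := by
  set Z := ∫⁻ z, ‖fderiv ℝ ψ z‖ₑ ^ ((m : ℝ) + 1) with hZ
  have hm : (0:ℝ) < m + 1 := by positivity
  have hcont : Continuous (fderiv ℝ ψ) := hψ.continuous_fderiv one_ne_zero
  calc ∫⁻ w in B, ‖ψ a - ψ w‖ₑ
      ≤ ∫⁻ w in B, ∫⁻ τ in Set.Ioo (0 : ℝ) 1,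
          ENNReal.ofReal R * ‖fderiv ℝ ψ (a + τ • (w - a))‖ₑ := by
        refine setLIntegral_mono' hB fun w hw => (enorm_sub_le_lintegral_fderiv hψ a w).trans ?_
        refine lintegral_mono fun τ => ?_
        rw [mul_comm]
        gcongr
        rw [← ofReal_norm]
        exact ENNReal.ofReal_le_ofReal (hR w hw)
    _ = ∫⁻ τ in Set.Ioo (0 : ℝ) 1, ∫⁻ w in B,
          ENNReal.ofReal R * ‖fderiv ℝ ψ (a + τ • (w - a))‖ₑ := by
        apply lintegral_lintegral_swap
        apply Measurable.aemeasurable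
        have : Continuous (fun p : (Fin m → ℝ) × ℝ => fderiv ℝ ψ (a + p.2 • (p.1 - a))) := by
          fun_prop
        exact (this.enorm.measurable).const_mul _
    _ ≤ ∫⁻ τ in Set.Ioo (0 : ℝ) 1, ENNReal.ofReal (τ ^ (-(m : ℝ) / (m + 1))) *
          (ENNReal.ofReal R * (volume B ^ ((m : ℝ) / (m + 1)) * Z ^ (1 / ((m : ℝ) + 1)))) := by
        refine setLIntegral_mono' measurableSet_Ioo fun τ hτ => ?_
        have hc : Continuous (fun w => fderiv ℝ ψ (a + τ • (w - a))) := by fun_prop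
        rw [lintegral_const_mul _ hc.enorm.measurable, mul_left_comm]
        gcongr
        have h1 := ENNReal.lintegral_mul_norm_pow_le (μ := volume.restrict B)
          (f := fun _ => (1 : ℝ≥0∞))
          (g := fun w => ‖fderiv ℝ ψ (a + τ • (w - a))‖ₑ ^ ((m : ℝ) + 1))
          aemeasurable_const (hc.enorm.measurable.pow_const _).aemeasurable
          (p := (m : ℝ) / (m + 1)) (q := 1 / ((m : ℝ) + 1)) (by positivity) (by positivity)
          (by field_simp)
        simp only [ENNReal.one_rpow, one_mul, ← ENNReal.rpow_mul, mul_one_div_cancel hm.ne',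
          ENNReal.rpow_one, lintegral_const, Measure.restrict_apply_univ] at h1
        refine h1.trans ?_
        rw [mul_left_comm]
        gcongr
        calc _ ≤ (∫⁻ w, ‖fderiv ℝ ψ (a + τ • (w - a))‖ₑ ^ ((m : ℝ) + 1)) ^ (1 / ((m : ℝ) + 1)) := by
              gcongr
              exact Measure.restrict_le_self
          _ = _ := by
              rw [lintegral_comp_add_smul_sub a hτ.1 (fun z => ‖fderiv ℝ ψ z‖ₑ ^ ((m : ℝ) + 1)),
                ENNReal.mul_rpow_of_nonneg _ _ (by positivity),
                ENNReal.ofReal_rpow_of_nonneg (by have := hτ.1; positivity) (by positivity), ← hZ]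
              congr 2
              rw [← Real.rpow_natCast, ← Real.rpow_neg hτ.1.le, ← Real.rpow_mul hτ.1.le]
              congr 1
              ring
    _ = _ := by
        rw [lintegral_mul_const _ (by fun_prop), lintegral_Ioo_rpow_neg]
        ring

/-- Morrey's inequality in dimension `m` with exponent `m + 1`. -/
theorem enorm_sub_le_rpow_mul_lintegral_fderiv {m : ℕ} {ψ : (Fin m → ℝ) → ℝ}
    (hψ : ContDiff ℝ 1 ψ) (x y : Fin m → ℝ) :
    ‖ψ x - ψ y‖ₑ ≤ 4 * (m + 1) * ‖x - y‖ₑ ^ (1 / ((m : ℝ) + 1)) *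
        (∫⁻ z, ‖fderiv ℝ ψ z‖ₑ ^ ((m : ℝ) + 1)) ^ (1 / ((m : ℝ) + 1)) := by
  rcases eq_or_ne x y with rfl | hxy
  · simp
  set Z := (∫⁻ z, ‖fderiv ℝ ψ z‖ₑ ^ ((m : ℝ) + 1)) ^ (1 / ((m : ℝ) + 1)) with hZ
  have hm : (0:ℝ) < m + 1 := by positivity
  set r := ‖x - y‖ with hr
  have hr0 : 0 < r := norm_pos_iff.mpr (sub_ne_zero.mpr hxy)
  -- Every point of this ball is within `2r` of both `x` and `y`, so the same averaged bound holds
  -- at both centres.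
  set B := Metric.closedBall x r with hB
  have hBm : MeasurableSet B := Metric.isClosed_closedBall.measurableSet
  have hx := setLIntegral_enorm_sub_le hψ (B := B) (a := x) (R := 2 * r)
    (fun w hw => by
      have : ‖w - x‖ ≤ r := by simpa [hB, dist_eq_norm] using hw
      linarith) hBm
  have hy := setLIntegral_enorm_sub_le hψ (B := B) (a := y) (R := 2 * r)
    (fun w hw => by
      have : ‖w - x‖ ≤ r := by simpa [hB, dist_eq_norm] using hw
      have h2 : ‖w - y‖ ≤ ‖w - x‖ + ‖x - y‖ := norm_sub_le_norm_sub_add_norm_sub _ _ _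
      linarith) hBm
  have hvol : volume B = ENNReal.ofReal ((2 * r) ^ m) := by
    rw [hB, Real.volume_pi_closedBall _ hr0.le]; simp
  have hv0 : volume B ≠ 0 := by
    rw [hvol]; simp only [ne_eq, ENNReal.ofReal_eq_zero, not_le]; positivity
  have hvt : volume B ≠ ⊤ := by rw [hvol]; exact ENNReal.ofReal_ne_top
  have hmul : ‖ψ x - ψ y‖ₑ * volume B ≤
      (ENNReal.ofReal (2 * r) * (m + 1) * (volume B ^ ((m : ℝ) / (m + 1)) * Z)) +
      (ENNReal.ofReal (2 * r) * (m + 1) * (volume B ^ ((m : ℝ) / (m + 1)) * Z)) := by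
    calc ‖ψ x - ψ y‖ₑ * volume B = ∫⁻ w in B, ‖ψ x - ψ y‖ₑ := by
          simp
      _ ≤ ∫⁻ w in B, (‖ψ x - ψ w‖ₑ + ‖ψ y - ψ w‖ₑ) := by
          refine lintegral_mono fun w => ?_
          have : ψ x - ψ y = (ψ x - ψ w) - (ψ y - ψ w) := by ring
          simp only [this]
          exact enorm_sub_le
      _ = (∫⁻ w in B, ‖ψ x - ψ w‖ₑ) + ∫⁻ w in B, ‖ψ y - ψ w‖ₑ :=
          lintegral_add_left (by have := hψ.continuous; fun_prop) _
      _ ≤ _ := add_le_add hx hy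
  have hdiv : ‖ψ x - ψ y‖ₑ ≤ 2 * (ENNReal.ofReal (2 * r) * (m + 1) *
      ((volume B)⁻¹ * volume B ^ ((m : ℝ) / (m + 1)) * Z)) := by
    calc ‖ψ x - ψ y‖ₑ = ‖ψ x - ψ y‖ₑ * volume B * (volume B)⁻¹ := by
          rw [mul_assoc, ENNReal.mul_inv_cancel hv0 hvt, mul_one]
      _ ≤ _ := by
          refine (mul_le_mul_left hmul (volume B)⁻¹).trans (le_of_eq ?_)
          ring
  refine hdiv.trans ?_
  -- As `|B| = (2r)^m`, the powers of `2r` add up to `1 - m/(m+1) = 1/(m+1)`. The constant `4` is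
  -- one factor `2` from the two centres and one from `2^{1/(m+1)} ≤ 2`.
  have key : ENNReal.ofReal (2 * r) * ((volume B)⁻¹ * volume B ^ ((m : ℝ) / (m + 1))) ≤
      2 * ‖x - y‖ₑ ^ (1 / ((m : ℝ) + 1)) := by
    rw [hvol, ← ENNReal.ofReal_inv_of_pos (by positivity),
      ENNReal.ofReal_rpow_of_pos (by positivity), ← ENNReal.ofReal_mul (by positivity),
      ← ENNReal.ofReal_mul (by positivity), ← ofReal_norm, ← hr,
      ENNReal.ofReal_rpow_of_pos hr0, ← ENNReal.ofReal_ofNat 2,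
      ← ENNReal.ofReal_mul (by positivity)]
    apply ENNReal.ofReal_le_ofReal
    have e1 : 2 * r * (((2 * r) ^ m)⁻¹ * ((2 * r) ^ m) ^ ((m : ℝ) / (m + 1))) =
        (2 * r) ^ (1 / ((m : ℝ) + 1)) := by
      have h2r : 0 < 2 * r := by positivity
      rw [← Real.rpow_natCast (2 * r), ← Real.rpow_mul h2r.le, ← Real.rpow_neg h2r.le,
        ← Real.rpow_add h2r]
      nth_rewrite 1 [← Real.rpow_one (2 * r)]
      rw [← Real.rpow_add h2r]
      congr 1
      field_simp
      ring
    rw [e1, Real.mul_rpow (by norm_num) hr0.le]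
    gcongr
    calc (2:ℝ) ^ (1 / ((m : ℝ) + 1)) ≤ 2 ^ (1 : ℝ) := by
          apply Real.rpow_le_rpow_of_exponent_le (by norm_num)
          rw [div_le_one hm]; linarith [(Nat.cast_nonneg m : (0:ℝ) ≤ m)]
      _ = 2 := by simp
  calc _ = 2 * (m + 1) * (ENNReal.ofReal (2 * r) *
        ((volume B)⁻¹ * volume B ^ ((m : ℝ) / (m + 1)))) * Z := by ring
    _ ≤ 2 * (m + 1) * (2 * ‖x - y‖ₑ ^ (1 / ((m : ℝ) + 1))) * Z := by gcongr
    _ = _ := by ring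

/-! ### Approximation by `C¹` functions with control of the support. -/

/-- Mollification at unit scale by a bump `f`. Since `∫ ∇f = 0`, the gradient at `x` is `∫ (h(x - t)
- h(x)) ∇f(t) dt`, so only the oscillation of `h` enters. -/
theorem exists_contDiff_approx_of_unit_oscillation (m : ℕ) :
    ∃ C : ℝ, 0 < C ∧ ∀ (h : (Fin m → ℝ) → ℝ) (δ : ℝ), Continuous h → 0 ≤ δ →
      (∀ a b, ‖a - b‖ ≤ 1 → |h a - h b| ≤ δ) →
      ∃ g : (Fin m → ℝ) → ℝ, ContDiff ℝ 1 g ∧ (∀ x, ‖fderiv ℝ g x‖ ≤ C * δ) ∧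
        (∀ x, |g x - h x| ≤ δ) ∧ ∀ x, (∀ y, ‖y - x‖ ≤ 1 → h y = 0) → g x = 0 := by
  let η : ContDiffBump (0 : Fin m → ℝ) := ⟨1 / 2, 1, by norm_num, by norm_num⟩
  let f : (Fin m → ℝ) → ℝ := η.normed volume
  have hfc : HasCompactSupport f := η.hasCompactSupport_normed
  have hfd : ContDiff ℝ 1 f := η.contDiff_normed
  have hfs : Function.support f ⊆ Metric.ball 0 1 := by
    rw [η.support_normed_eq]
  have hdc : HasCompactSupport (fderiv ℝ f) := hfc.fderiv ℝ
  have hdcont : Continuous (fderiv ℝ f) := hfd.continuous_fderiv one_ne_zero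
  have hdint : Integrable (fderiv ℝ f) := hdcont.integrable_of_hasCompactSupport hdc
  have hf0 : ∀ t, t ∉ Metric.closedBall (0 : Fin m → ℝ) 1 → fderiv ℝ f t = 0 := by
    intro t ht
    by_contra hne
    apply ht
    have h1 : t ∈ tsupport f := support_fderiv_subset ℝ (Function.mem_support.mpr hne)
    exact Metric.closure_ball_subset_closedBall (closure_mono hfs h1)
  let C0 := ∫ t, ‖fderiv ℝ f t‖
  have hC0 : 0 ≤ C0 := integral_nonneg fun _ => norm_nonneg _
  -- The summand `1` keeps the constant positive even if `C0 = 0`, as happens for `m = 0`.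
  refine ⟨C0 + 1, by positivity, fun h δ hc hδ hosc => ?_⟩
  let L := ContinuousLinearMap.lsmul ℝ ℝ (E := ℝ)
  have hloc : LocallyIntegrable h (volume : Measure (Fin m → ℝ)) := hc.locallyIntegrable
  have hone : convolution f (fun _ => (1:ℝ)) L = fun _ => (1:ℝ) := by
    funext x
    rw [convolution_def]
    simpa [L] using η.integral_normed (μ := volume)
  -- Differentiating `f * 1 = 1` shows that `∇f` has integral zero.
  have hderone : ∀ x : Fin m → ℝ,
      convolution (fderiv ℝ f) (fun _ => (1:ℝ)) (L.precompL (Fin m → ℝ)) volume x = 0 := by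
    intro x
    have h1 := hfc.hasFDerivAt_convolution_left L hfd
      (continuous_const (y := (1:ℝ))).locallyIntegrable (μ := volume) x
    rw [hone] at h1
    exact h1.unique (hasFDerivAt_const _ _)
  refine ⟨convolution f h L, hfc.contDiff_convolution_left L (n := 1) hfd hloc, ?_, ?_, ?_⟩
  · intro x
    rw [(hfc.hasFDerivAt_convolution_left L hfd hloc x).fderiv]
    have hex : Integrable (fun t => (L.precompL (Fin m → ℝ)) (fderiv ℝ f t) (h (x - t))) :=
      (hdc.convolutionExists_left (L.precompL (Fin m → ℝ)) hdcont hloc x)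
    have e : convolution (fderiv ℝ f) h (L.precompL (Fin m → ℝ)) volume x =
        ∫ t, (h (x - t) - h x) • fderiv ℝ f t := by
      have h0 := hderone x
      rw [convolution_def] at h0 ⊢
      have h2 : ∀ (t : Fin m → ℝ) (c : ℝ), (L.precompL (Fin m → ℝ)) (fderiv ℝ f t) c =
          c • fderiv ℝ f t := by
        intro t c
        ext v
        simp [L, ContinuousLinearMap.precompL_apply, mul_comm]
      have h3 : ∀ t : Fin m → ℝ, (L.precompL (Fin m → ℝ)) (fderiv ℝ f t) 1 = fderiv ℝ f t :=
        fun t => (h2 t 1).trans (one_smul ℝ (fderiv ℝ f t))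
      have h4 : ∫ t, fderiv ℝ f t = 0 :=
        (integral_congr_ae (ae_of_all _ fun t => (h3 t).symm)).trans h0
      simp only [h2] at hex ⊢
      have h5 : ∀ t, (h (x - t) - h x) • fderiv ℝ f t =
          h (x - t) • fderiv ℝ f t - h x • fderiv ℝ f t := fun t =>
        sub_smul (h (x - t)) (h x) (fderiv ℝ f t)
      have h6 : ∫ t, h x • fderiv ℝ f t = 0 := by
        rw [integral_smul, h4, smul_zero]
      refine Eq.symm ((integral_congr_ae (ae_of_all _ h5)).trans
        ((integral_sub hex (hdint.smul (h x))).trans ?_))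
      refine (congrArg (fun v => _ - v) h6).trans (sub_zero _)
    rw [e]
    calc ‖∫ t, (h (x - t) - h x) • fderiv ℝ f t‖ ≤ ∫ t, δ * ‖fderiv ℝ f t‖ := by
          refine norm_integral_le_of_norm_le (hdint.norm.const_mul δ) (ae_of_all _ fun t => ?_)
          rw [norm_smul]
          by_cases ht : t ∈ Metric.closedBall (0 : Fin m → ℝ) 1
          · gcongr
            refine hosc _ _ ?_
            simpa using ht
          · simp [hf0 t ht]
      _ = C0 * δ := by rw [integral_const_mul, mul_comm]
      _ ≤ _ := by nlinarith
  · intro x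
    have := dist_convolution_le (μ := volume) (f := f) (g := h) (x₀ := x) (R := 1) (ε := δ)
      (z₀ := h x) hδ hfs η.nonneg_normed η.integral_normed hc.aestronglyMeasurable
      (fun y hy => by
        rw [Real.dist_eq]
        exact hosc _ _ (by rw [← dist_eq_norm]; exact (Metric.mem_ball.mp hy).le))
    rwa [Real.dist_eq] at this
  · intro x hx
    rw [convolution_def]
    apply integral_eq_zero_of_ae
    refine ae_of_all _ fun t => ?_
    by_cases ht : t ∈ Metric.ball (0 : Fin m → ℝ) 1
    · have : h (x - t) = 0 := hx _ (by simpa using (mem_ball_zero_iff.mp ht).le)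
      simp [this]
    · have : f t = 0 := by
        by_contra hne
        exact ht (hfs hne)
      simp [this]

/-- A continuous function that vanishes off a bounded open set and has small oscillation at
scale `ε` is approximated by `C¹` functions supported in that open set. -/
theorem exists_contDiff_approx_of_oscillation (m : ℕ) :
    ∃ C : ℝ, 0 < C ∧ ∀ (Q : Set (Fin m → ℝ)) (ψ : (Fin m → ℝ) → ℝ) (δ ε : ℝ),
      Bornology.IsBounded Q → Continuous ψ → (∀ x, x ∉ Q → ψ x = 0) → 0 < δ → 0 < ε →
      (∀ a b, ‖a - b‖ ≤ ε → |ψ a - ψ b| ≤ δ) →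
      ∃ g : (Fin m → ℝ) → ℝ, ContDiff ℝ 1 g ∧ HasCompactSupport g ∧ tsupport g ⊆ Q ∧
        (∀ x, ‖fderiv ℝ g x‖ ≤ C * δ / ε) ∧ ∀ x, |g x - ψ x| ≤ 3 * δ := by
  obtain ⟨C, hC, H⟩ := exists_contDiff_approx_of_unit_oscillation m
  refine ⟨C, hC, fun Q ψ δ ε hQ hψ hψQ hδ hε hosc => ?_⟩
  -- Soft thresholding: 1-Lipschitz, zero on `[-2δ, 2δ]`, and within `2δ` of the identity. Applied
  -- before mollifying, it keeps the support inside `Q`; the final error `3δ` is `2δ` from here plus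
  -- `δ` from mollification.
  let T : ℝ → ℝ := fun u => u - max (-(2 * δ)) (min u (2 * δ))
  have hTlip : ∀ u v, |T u - T v| ≤ |u - v| := by
    have aux : ∀ u v, u ≤ v → |T u - T v| ≤ |u - v| := by
      intro u v huv
      simp only [T]
      rw [abs_of_nonpos (a := u - v) (by linarith), abs_le]
      rcases max_cases (-(2 * δ)) (min u (2 * δ)) with h1 | h1 <;>
      rcases max_cases (-(2 * δ)) (min v (2 * δ)) with h2 | h2 <;>
      rcases min_cases u (2 * δ) with h3 | h3 <;>
      rcases min_cases v (2 * δ) with h4 | h4 <;>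
      constructor <;> linarith
    intro u v
    rcases le_total u v with h | h
    · exact aux u v h
    · rw [abs_sub_comm, abs_sub_comm u]; exact aux v u h
  have hTsub : ∀ u, |T u - u| ≤ 2 * δ := by
    intro u
    simp only [T, sub_sub_cancel_left, abs_neg]
    rw [abs_le]
    exact ⟨le_max_left _ _, max_le (by linarith) (min_le_right _ _)⟩
  have hT0 : ∀ u, |u| ≤ 2 * δ → T u = 0 := by
    intro u hu
    rw [abs_le] at hu
    simp only [T]
    rw [min_eq_left hu.2, max_eq_right hu.1, sub_self]
  have hTc : Continuous T := by fun_prop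
  obtain ⟨g, hg1, hg2, hg3, hg4⟩ := H (fun z => T (ψ (ε • z))) δ (by fun_prop) hδ.le
    (fun a b hab => (hTlip _ _).trans (hosc _ _ (by
      rw [← smul_sub, norm_smul, Real.norm_of_nonneg hε.le]
      nlinarith)))
  -- If `|ψ x| < δ`, then `|ψ| ≤ 2δ` throughout the `ε`-ball about `x`, so the thresholded function
  -- vanishes there and so does its mollification at `x`.
  have hsupp : Function.support (fun x => g (ε⁻¹ • x)) ⊆ {x | δ ≤ |ψ x|} := by
    intro x hx
    by_contra hlt
    simp only [Set.mem_ofPred_eq, not_le] at hlt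
    apply hx
    refine hg4 _ fun y hy => hT0 _ ?_
    have h1 : |ψ (ε • y) - ψ x| ≤ δ := by
      apply hosc
      have : ε • y - x = ε • (y - ε⁻¹ • x) := by
        rw [smul_sub, smul_smul, mul_inv_cancel₀ hε.ne', one_smul]
      rw [this, norm_smul, Real.norm_of_nonneg hε.le]
      nlinarith
    have h2 := abs_add_le (ψ (ε • y) - ψ x) (ψ x)
    rw [sub_add_cancel] at h2
    linarith
  have hts : tsupport (fun x => g (ε⁻¹ • x)) ⊆ {x | δ ≤ |ψ x|} :=
    closure_minimal hsupp (isClosed_le continuous_const hψ.abs)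
  have hQsub : {x | δ ≤ |ψ x|} ⊆ Q := by
    intro x hx
    by_contra hxQ
    have : δ ≤ |ψ x| := hx
    rw [hψQ x hxQ, abs_zero] at this
    linarith
  refine ⟨fun x => g (ε⁻¹ • x), by fun_prop, ?_, hts.trans hQsub, ?_, ?_⟩
  · exact Metric.isCompact_of_isClosed_isBounded (isClosed_tsupport _)
      (hQ.subset (hts.trans hQsub))
  · intro x
    have hd := (hg1.differentiable one_ne_zero (ε⁻¹ • x)).hasFDerivAt.comp x
      ((hasFDerivAt_id x).const_smul ε⁻¹)
    have : fderiv ℝ (fun x => g (ε⁻¹ • x)) x = ε⁻¹ • fderiv ℝ g (ε⁻¹ • x) := by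
      refine (HasFDerivAt.fderiv hd).trans ?_
      ext v
      simp
    rw [this, norm_smul, Real.norm_of_nonneg (by positivity), div_eq_inv_mul]
    gcongr
    exact hg2 _
  · intro x
    have h1 := hg3 (ε⁻¹ • x)
    simp only [smul_smul, mul_inv_cancel₀ hε.ne', one_smul] at h1
    have h2 := hTsub (ψ x)
    have h3 := abs_add_le (g (ε⁻¹ • x) - T (ψ x)) (T (ψ x) - ψ x)
    rw [sub_add_sub_cancel] at h3
    linarith

/-! ### The cube and its slices. -/

/-- The open unit cube in the product `Fin n → ℝ`. -/
def openCube (n : ℕ) : Set (Fin n → ℝ) := Set.univ.pi fun _ => Set.Ioo 0 1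

theorem mem_openCube {n : ℕ} {x : Fin n → ℝ} : x ∈ openCube n ↔ ∀ i, x i ∈ Set.Ioo (0 : ℝ) 1 := by
  simp [openCube]

theorem isOpen_openCube (n : ℕ) : IsOpen (openCube n) :=
  isOpen_set_pi Set.finite_univ fun _ _ => isOpen_Ioo

theorem isBounded_openCube (n : ℕ) : Bornology.IsBounded (openCube n) :=
  Bornology.IsBounded.pi fun _ => Metric.isBounded_Ioo 0 1

theorem volume_openCube (n : ℕ) : volume (openCube n) = 1 := by
  simp [openCube, Real.volume_pi_Ioo]

/-- The point with `i`-th coordinate `t` and remaining coordinates `y`. -/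
def slicePoint {m : ℕ} (i : Fin (m + 1)) (t : ℝ) (y : Fin m → ℝ) : Fin (m + 1) → ℝ :=
  i.insertNth t y

section slicePoint

variable {m : ℕ} (i : Fin (m + 1))

@[simp] theorem slicePoint_same (t : ℝ) (y : Fin m → ℝ) : slicePoint i t y i = t := by
  simp [slicePoint]

@[simp] theorem slicePoint_succAbove (t : ℝ) (y : Fin m → ℝ) (k : Fin m) :
    slicePoint i t y (i.succAbove k) = y k := by
  simp [slicePoint]

theorem slicePoint_mem_openCube {t : ℝ} {y : Fin m → ℝ} :
    slicePoint i t y ∈ openCube (m + 1) ↔ t ∈ Set.Ioo (0 : ℝ) 1 ∧ y ∈ openCube m := by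
  simp only [mem_openCube, Fin.forall_iff_succAbove i, slicePoint_same, slicePoint_succAbove]

theorem continuous_slicePoint :
    Continuous fun p : ℝ × (Fin m → ℝ) => slicePoint i p.1 p.2 :=
  Continuous.finInsertNth (A := fun _ => ℝ) i continuous_fst continuous_snd

theorem slicePoint_add_left (t s : ℝ) (y : Fin m → ℝ) :
    slicePoint i (t + s) y = slicePoint i t y + s • Pi.single i 1 := by
  funext j
  revert j
  rw [Fin.forall_iff_succAbove i]
  refine ⟨by simp, fun k => by simp [Fin.succAbove_ne]⟩

theorem slicePoint_add_right (t s : ℝ) (y : Fin m → ℝ) (k : Fin m) :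
    slicePoint i t (y + s • Pi.single k 1) =
      slicePoint i t y + s • Pi.single (i.succAbove k) 1 := by
  funext j
  revert j
  rw [Fin.forall_iff_succAbove i]
  refine ⟨by simp [(Fin.succAbove_ne i k).symm], fun l => ?_⟩
  by_cases h : l = k
  · subst h; simp
  · simp [h]

theorem lintegral_slicePoint {f : (Fin (m + 1) → ℝ) → ℝ≥0∞} (hf : Measurable f) :
    ∫⁻ t, ∫⁻ y, f (slicePoint i t y) = ∫⁻ x, f x := by
  have h := ((volume_preserving_piFinSuccAbove (fun _ : Fin (m + 1) => ℝ) i).symm _)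
  rw [← h.lintegral_comp hf, Measure.volume_eq_prod, lintegral_prod]
  · rfl
  · exact (hf.comp (MeasurableEquiv.measurable _)).aemeasurable

theorem integral_slicePoint {f : (Fin (m + 1) → ℝ) → ℝ} (hf : Integrable f) :
    ∫ t, ∫ y, f (slicePoint i t y) = ∫ x, f x := by
  have h := ((volume_preserving_piFinSuccAbove (fun _ : Fin (m + 1) => ℝ) i).symm _)
  rw [← h.integral_comp' f, Measure.volume_eq_prod, integral_prod]
  · rfl
  · exact (h.integrable_comp_emb (MeasurableEquiv.measurableEmbedding _)).mpr hf

end slicePoint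

/-! ### Fluxes of divergence free fields through slices. -/

/-- A bounded measurable field, `C¹` and divergence free on the open unit cube, zero outside. -/
structure IsSolenoidalOnCube {n : ℕ} (U : (Fin n → ℝ) → (Fin n → ℝ)) : Prop where
  measurable : Measurable U
  eq_zero : ∀ x, x ∉ openCube n → U x = 0
  bounded : ∃ M, ∀ x, ‖U x‖ ≤ M
  contDiffOn : ContDiffOn ℝ 1 U (openCube n)
  div_eq_zero : ∀ x ∈ openCube n, ∑ j, fderiv ℝ U x (Pi.single j 1) j = 0

/-- The product of a function continuous on an open set with a continuous function compactly
supported in that set is integrable. -/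
theorem ContinuousOn.integrable_mul_of_tsupport_subset {X : Type*} [TopologicalSpace X]
    [MeasurableSpace X] [OpensMeasurableSpace X] {μ : Measure X} [IsFiniteMeasureOnCompacts μ]
    {g ψ : X → ℝ} {s : Set X} (hs : IsOpen s) (hg : ContinuousOn g s) (hψ : Continuous ψ)
    (hc : HasCompactSupport ψ) (hψs : tsupport ψ ⊆ s) : Integrable (fun x => g x * ψ x) μ := by
  have hcont : Continuous fun x => g x * ψ x := by
    rw [continuous_iff_continuousAt]
    intro x
    by_cases hx : x ∈ s
    · exact (hg.continuousAt (hs.mem_nhds hx)).mul hψ.continuousAt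
    · have h0 : ψ =ᶠ[nhds x] 0 := notMem_tsupport_iff_eventuallyEq.mp fun h => hx (hψs h)
      have : (fun x => g x * ψ x) =ᶠ[nhds x] fun _ => 0 := by
        filter_upwards [h0] with y hy
        simp [hy]
      exact continuousAt_const.congr this.symm
  exact hcont.integrable_of_hasCompactSupport hc.mul_left

namespace IsSolenoidalOnCube

theorem hasFDerivAt {n : ℕ} {U : (Fin n → ℝ) → (Fin n → ℝ)} (hU : IsSolenoidalOnCube U)
    {x : Fin n → ℝ} (hx : x ∈ openCube n) : HasFDerivAt U (fderiv ℝ U x) x :=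
  ((hU.contDiffOn.differentiableOn one_ne_zero).differentiableAt
    ((isOpen_openCube n).mem_nhds hx)).hasFDerivAt

theorem hasFDerivAt_apply {n : ℕ} {U : (Fin n → ℝ) → (Fin n → ℝ)} (hU : IsSolenoidalOnCube U)
    {x : Fin n → ℝ} (hx : x ∈ openCube n) (j : Fin n) :
    HasFDerivAt (fun x => U x j) ((ContinuousLinearMap.proj j).comp (fderiv ℝ U x)) x :=
  (ContinuousLinearMap.proj (R := ℝ) (φ := fun _ : Fin n => ℝ) j).hasFDerivAt.comp x
    (hU.hasFDerivAt hx)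

theorem continuousOn_fderiv_apply {n : ℕ} {U : (Fin n → ℝ) → (Fin n → ℝ)}
    (hU : IsSolenoidalOnCube U) (v : Fin n → ℝ) (j : Fin n) :
    ContinuousOn (fun x => fderiv ℝ U x v j) (openCube n) := by
  have h1 : ContinuousOn (fderiv ℝ U) (openCube n) :=
    hU.contDiffOn.continuousOn_fderiv_of_isOpen (isOpen_openCube n) le_rfl
  exact (continuous_apply j).comp_continuousOn (h1.clm_apply continuousOn_const)

theorem continuousOn_slice {m : ℕ} {g : (Fin (m + 1) → ℝ) → ℝ}
    (hg : ContinuousOn g (openCube (m + 1))) (i : Fin (m + 1)) {s : ℝ}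
    (hs : s ∈ Set.Ioo (0 : ℝ) 1) :
    ContinuousOn (fun y => g (slicePoint i s y)) (openCube m) :=
  hg.comp ((continuous_slicePoint i).comp (Continuous.prodMk_right s)).continuousOn
    fun _ hy => (slicePoint_mem_openCube i).mpr ⟨hs, hy⟩

variable {m : ℕ} {U : (Fin (m + 1) → ℝ) → (Fin (m + 1) → ℝ)}

theorem continuousOn_apply (hU : IsSolenoidalOnCube U) (j : Fin (m + 1)) :
    ContinuousOn (fun x => U x j) (openCube (m + 1)) :=
  (continuous_apply j).comp_continuousOn hU.contDiffOn.continuousOn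

/-- Integration by parts on a slice, using that the field is divergence free. -/
theorem integral_slice_fderiv (hU : IsSolenoidalOnCube U) (i : Fin (m + 1))
    {ψ : (Fin m → ℝ) → ℝ} (hψ : ContDiff ℝ 1 ψ) (hc : HasCompactSupport ψ)
    (hψs : tsupport ψ ⊆ openCube m) {s : ℝ} (hs : s ∈ Set.Ioo (0 : ℝ) 1) :
    ∫ y, fderiv ℝ U (slicePoint i s y) (Pi.single i 1) i * ψ y =
      ∑ k : Fin m, ∫ y, U (slicePoint i s y) (i.succAbove k) * fderiv ℝ ψ y (Pi.single k 1) := by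
  have hopen := isOpen_openCube m
  have hint : ∀ (v : Fin (m + 1) → ℝ) (j : Fin (m + 1)),
      Integrable fun y => fderiv ℝ U (slicePoint i s y) v j * ψ y := fun v j =>
    (continuousOn_slice (hU.continuousOn_fderiv_apply v j) i hs).integrable_mul_of_tsupport_subset
      hopen hψ.continuous hc hψs
  have hibp : ∀ k : Fin m,
      ∫ y, U (slicePoint i s y) (i.succAbove k) * fderiv ℝ ψ y (Pi.single k 1) =
        -∫ y, fderiv ℝ U (slicePoint i s y) (Pi.single (i.succAbove k) 1) (i.succAbove k) * ψ y := by
    intro k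
    have hdψc : Continuous fun y => fderiv ℝ ψ y (Pi.single k 1) :=
      (hψ.continuous_fderiv one_ne_zero).clm_apply continuous_const
    have hdts : tsupport (fun y => fderiv ℝ ψ y (Pi.single k 1)) ⊆ tsupport ψ :=
      tsupport_fderiv_apply_subset ℝ _
    refine integral_bilinear_hasLineDerivAt_right_eq_neg_left_of_integrable
      (B := ContinuousLinearMap.mul ℝ ℝ) (v := Pi.single k 1)
      (f := fun y => U (slicePoint i s y) (i.succAbove k)) (g := ψ)
      (f' := fun y => fderiv ℝ U (slicePoint i s y) (Pi.single (i.succAbove k) 1) (i.succAbove k))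
      (g' := fun y => fderiv ℝ ψ y (Pi.single k 1)) (hint _ _) ?_ ?_ ?_ ?_
    · exact (continuousOn_slice (hU.continuousOn_apply _) i hs).integrable_mul_of_tsupport_subset
        hopen hdψc (hc.fderiv_apply ℝ _) (hdts.trans hψs)
    · exact (continuousOn_slice (hU.continuousOn_apply _) i hs).integrable_mul_of_tsupport_subset
        hopen hψ.continuous hc hψs
    · intro y hy
      have h1 := (hU.hasFDerivAt_apply ((slicePoint_mem_openCube i).mpr ⟨hs, hψs hy⟩)
        (i.succAbove k)).hasLineDerivAt (Pi.single (i.succAbove k) 1)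
      simp only [HasLineDerivAt, slicePoint_add_right] at h1 ⊢
      exact h1
    · intro y _
      exact (hψ.differentiable one_ne_zero y).hasFDerivAt.hasLineDerivAt _
  rw [Finset.sum_congr rfl fun k _ => hibp k, Finset.sum_neg_distrib,
    ← integral_finsetSum _ fun k _ => hint _ _, ← integral_neg]
  refine integral_congr_ae (ae_of_all _ fun y => ?_)
  by_cases hy : y ∈ openCube m
  · have h0 := hU.div_eq_zero _ ((slicePoint_mem_openCube i).mpr ⟨hs, hy⟩)
    rw [Fin.sum_univ_succAbove _ i] at h0
    simp only [← Finset.sum_mul]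
    rw [eq_neg_of_add_eq_zero_left h0]
    ring
  · have : ψ y = 0 := image_eq_zero_of_notMem_tsupport fun h => hy (hψs h)
    simp [this]

/-- Differentiation under the integral followed by `integral_slice_fderiv`: no derivative of the
field survives. The derivative of `U` may blow up at the boundary of the cube, so the dominating
constant is taken on a compact product with `tsupport ψ`. -/
theorem hasDerivAt_integral_slice (hU : IsSolenoidalOnCube U) (i : Fin (m + 1))
    {ψ : (Fin m → ℝ) → ℝ} (hψ : ContDiff ℝ 1 ψ) (hc : HasCompactSupport ψ)
    (hψs : tsupport ψ ⊆ openCube m) {s : ℝ} (hs : s ∈ Set.Ioo (0 : ℝ) 1) :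
    HasDerivAt (fun s => ∫ y, U (slicePoint i s y) i * ψ y)
      (∑ k : Fin m, ∫ y, U (slicePoint i s y) (i.succAbove k) * fderiv ℝ ψ y (Pi.single k 1)) s := by
  have hopen := isOpen_openCube m
  obtain ⟨r, hr, hball⟩ := Metric.nhds_basis_closedBall.mem_iff.mp (isOpen_Ioo.mem_nhds hs)
  have hK : IsCompact (Metric.closedBall s r ×ˢ tsupport ψ) := (isCompact_closedBall s r).prod hc
  have hcont : ContinuousOn (fun p : ℝ × (Fin m → ℝ) =>
      fderiv ℝ U (slicePoint i p.1 p.2) (Pi.single i 1) i * ψ p.2)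
      (Metric.closedBall s r ×ˢ tsupport ψ) := by
    refine ContinuousOn.mul ?_ (hψ.continuous.comp continuous_snd).continuousOn
    exact (hU.continuousOn_fderiv_apply (Pi.single i 1) i).comp
      (continuous_slicePoint i).continuousOn
      fun p hp => (slicePoint_mem_openCube i).mpr ⟨hball hp.1, hψs hp.2⟩
  obtain ⟨M, hM⟩ := hK.exists_bound_of_continuousOn hcont
  rw [← hU.integral_slice_fderiv i hψ hc hψs hs]
  refine (hasDerivAt_integral_of_dominated_loc_of_deriv_le
    (bound := (tsupport ψ).indicator fun _ => M)
    (F' := fun s y => fderiv ℝ U (slicePoint i s y) (Pi.single i 1) i * ψ y)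
    (Metric.closedBall_mem_nhds s hr) ?_ ?_ ?_ ?_ ?_ ?_).2
  · filter_upwards [isOpen_Ioo.mem_nhds hs] with t ht
    exact ((continuousOn_slice (hU.continuousOn_apply _) i ht).integrable_mul_of_tsupport_subset
        hopen hψ.continuous hc hψs).aestronglyMeasurable
  · exact (continuousOn_slice (hU.continuousOn_apply _) i hs).integrable_mul_of_tsupport_subset
        hopen hψ.continuous hc hψs
  · exact ((continuousOn_slice (hU.continuousOn_fderiv_apply _ _) i
      hs).integrable_mul_of_tsupport_subset hopen hψ.continuous hc hψs).aestronglyMeasurable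
  · refine ae_of_all _ fun y t ht => ?_
    by_cases hy : y ∈ tsupport ψ
    · rw [Set.indicator_of_mem hy]
      exact hM (t, y) ⟨ht, hy⟩
    · rw [Set.indicator_of_notMem hy, image_eq_zero_of_notMem_tsupport hy]
      simp
  · exact (integrable_indicator_iff (isClosed_tsupport ψ).measurableSet).mpr
      (integrableOn_const hc.measure_lt_top.ne)
  · refine ae_of_all _ fun y t ht => ?_
    by_cases hy : y ∈ tsupport ψ
    · refine HasDerivAt.mul_const ?_ _
      have h1 := (hU.hasFDerivAt_apply ((slicePoint_mem_openCube i).mpr ⟨hball ht, hψs hy⟩)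
        i).hasLineDerivAt (Pi.single i 1)
      simp only [HasLineDerivAt, ← slicePoint_add_left] at h1
      have h2 := (hasDerivAt_id t).sub_const t
      have h3 := HasDerivAt.comp t (h₂ := fun τ => U (slicePoint i (t + τ) y) i)
        (h := fun x => id x - t) (by simpa using h1) h2
      simpa [Function.comp_def] using h3
    · rw [image_eq_zero_of_notMem_tsupport hy]
      simpa using hasDerivAt_const t (0:ℝ)

end IsSolenoidalOnCube

namespace IsSolenoidalOnCube

variable {m : ℕ} {U : (Fin (m + 1) → ℝ) → (Fin (m + 1) → ℝ)}

theorem exists_lintegral_slice_le (hU : IsSolenoidalOnCube U) (i : Fin (m + 1)) :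
    ∃ M : ℝ, ∀ s, ∫⁻ y, ‖U (slicePoint i s y)‖ₑ ≤ ENNReal.ofReal M := by
  obtain ⟨M, hM⟩ := hU.bounded
  refine ⟨M, fun s => ?_⟩
  calc ∫⁻ y, ‖U (slicePoint i s y)‖ₑ
      ≤ ∫⁻ y, (openCube m).indicator (fun _ => ENNReal.ofReal M) y := by
        refine lintegral_mono fun y => ?_
        by_cases hy : y ∈ openCube m
        · rw [Set.indicator_of_mem hy, ← ofReal_norm]
          exact ENNReal.ofReal_le_ofReal (hM _)
        · rw [hU.eq_zero _ fun h => hy ((slicePoint_mem_openCube i).mp h).2]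
          simp
    _ = _ := by
        rw [lintegral_indicator (isOpen_openCube m).measurableSet]
        simp [volume_openCube]

theorem enorm_integral_slice_mul_le (i j : Fin (m + 1)) {ψ : (Fin m → ℝ) → ℝ} {L : ℝ}
    (hL : ∀ y, |ψ y| ≤ L) (s : ℝ) :
    ‖∫ y, U (slicePoint i s y) j * ψ y‖ₑ ≤
      ENNReal.ofReal L * ∫⁻ y, ‖U (slicePoint i s y)‖ₑ := by
  refine (enorm_integral_le_lintegral_enorm _).trans ?_
  rw [← lintegral_const_mul' _ _ ENNReal.ofReal_ne_top]
  refine lintegral_mono fun y => ?_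
  rw [enorm_mul, mul_comm]
  gcongr
  · rw [← ofReal_norm]; exact ENNReal.ofReal_le_ofReal (hL y)
  · rw [← ofReal_norm, ← ofReal_norm]; exact ENNReal.ofReal_le_ofReal (norm_le_pi_norm _ j)

/-- The flux of a divergence free field through a slice, tested against a `C¹` function supported
in the open cube, is controlled by the total mass. -/
theorem enorm_integral_slice_le (hU : IsSolenoidalOnCube U) (i : Fin (m + 1))
    {ψ : (Fin m → ℝ) → ℝ} (hψ : ContDiff ℝ 1 ψ) (hc : HasCompactSupport ψ)
    (hψs : tsupport ψ ⊆ openCube m) {L : ℝ} (hL : ∀ y, |ψ y| ≤ L)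
    (hL' : ∀ y, ‖fderiv ℝ ψ y‖ ≤ L) {t : ℝ} (ht : t ∈ Set.Ioo (0 : ℝ) 1) :
    ‖∫ y, U (slicePoint i t y) i * ψ y‖ₑ ≤ (m + 1) * ENNReal.ofReal L * ∫⁻ x, ‖U x‖ₑ := by
  set F : ℝ → ℝ := fun s => ∫ y, U (slicePoint i s y) i * ψ y with hF
  set A : ℝ → ℝ≥0∞ := fun s => ∫⁻ y, ‖U (slicePoint i s y)‖ₑ with hA
  have hAB : ∫⁻ s, A s = ∫⁻ x, ‖U x‖ₑ := lintegral_slicePoint i hU.measurable.enorm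
  have hAm : Measurable A :=
    (hU.measurable.comp (continuous_slicePoint i).measurable).enorm.lintegral_prod_right'
  have hdF : ∀ s ∈ Set.Ioo (0 : ℝ) 1, HasDerivAt F (deriv F s) s := fun s hs =>
    (hU.hasDerivAt_integral_slice i hψ hc hψs hs).differentiableAt.hasDerivAt
  have hdL : ∀ (k : Fin m) y, |fderiv ℝ ψ y (Pi.single k 1)| ≤ L := fun k y => by
    have h1 := (fderiv ℝ ψ y).le_of_opNorm_le (hL' y) (Pi.single k 1)
    rwa [Pi.norm_single, norm_one, mul_one] at h1
  have hdb : ∀ s ∈ Set.Ioo (0 : ℝ) 1, ‖deriv F s‖ₑ ≤ m * ENNReal.ofReal L * A s := by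
    intro s hs
    rw [(hU.hasDerivAt_integral_slice i hψ hc hψs hs).deriv]
    refine (enorm_sum_le _ _).trans ?_
    refine (Finset.sum_le_sum fun k _ => enorm_integral_slice_mul_le i (i.succAbove k)
      (hdL k) s).trans (le_of_eq ?_)
    simp [mul_assoc, hA]
  -- Integrating the derivative bound between slices replaces the slice masses by the total mass.
  have hsub : ∀ s ∈ Set.Ioo (0 : ℝ) 1, ‖F t - F s‖ₑ ≤ m * ENNReal.ofReal L * ∫⁻ x, ‖U x‖ₑ := by
    intro s hs
    have hIoo : Set.uIcc s t ⊆ Set.Ioo (0 : ℝ) 1 := Set.ordConnected_Ioo.uIcc_subset hs ht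
    have hi : IntervalIntegrable (deriv F) volume s t := by
      obtain ⟨M, hM⟩ := hU.exists_lintegral_slice_le i
      rw [intervalIntegrable_iff]
      refine Measure.integrableOn_of_bounded (M := (m * ENNReal.ofReal L * ENNReal.ofReal M).toReal)
        (by simp [Set.uIoc]) (measurable_deriv F).aestronglyMeasurable ?_
      filter_upwards [ae_restrict_mem measurableSet_uIoc] with τ hτ
      rw [← toReal_enorm]
      refine ENNReal.toReal_mono (by finiteness) ?_
      refine (hdb τ (hIoo (Set.uIoc_subset_uIcc hτ))).trans ?_
      gcongr
      exact hM τ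
    rw [← intervalIntegral.integral_eq_sub_of_hasDerivAt (fun τ hτ => hdF τ (hIoo hτ)) hi]
    calc ‖∫ τ in s..t, deriv F τ‖ₑ = ‖∫ τ in Set.uIoc s t, deriv F τ‖ₑ := by
          rw [← ofReal_norm, intervalIntegral.norm_integral_eq_norm_integral_uIoc, ofReal_norm]
      _ ≤ ∫⁻ τ in Set.uIoc s t, ‖deriv F τ‖ₑ := enorm_integral_le_lintegral_enorm _
      _ ≤ ∫⁻ τ in Set.uIoc s t, m * ENNReal.ofReal L * A τ :=
          setLIntegral_mono' measurableSet_uIoc fun τ hτ => hdb τ (hIoo (Set.uIoc_subset_uIcc hτ))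
      _ ≤ ∫⁻ τ, m * ENNReal.ofReal L * A τ := setLIntegral_le_lintegral _ _
      _ = _ := by rw [lintegral_const_mul _ hAm, hAB]
  -- The flux need not vanish at the faces, so there is no zero initial value; averaging over the
  -- reference slice `s` replaces it. The average of `|F s|` adds `1` to the factor `m` from `hsub`.
  calc ‖F t‖ₑ = ∫⁻ s in Set.Ioo (0 : ℝ) 1, ‖F t‖ₑ := by simp
    _ ≤ ∫⁻ s in Set.Ioo (0 : ℝ) 1,
          (m * ENNReal.ofReal L * (∫⁻ x, ‖U x‖ₑ) + ENNReal.ofReal L * A s) := by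
        refine setLIntegral_mono' measurableSet_Ioo fun s hs => ?_
        calc ‖F t‖ₑ = ‖(F t - F s) + F s‖ₑ := by rw [sub_add_cancel]
          _ ≤ ‖F t - F s‖ₑ + ‖F s‖ₑ := enorm_add_le _ _
          _ ≤ _ := add_le_add (hsub s hs) (enorm_integral_slice_mul_le i i hL s)
    _ = m * ENNReal.ofReal L * (∫⁻ x, ‖U x‖ₑ) +
          ENNReal.ofReal L * ∫⁻ s in Set.Ioo (0 : ℝ) 1, A s := by
        rw [lintegral_add_left measurable_const, lintegral_const_mul _ hAm]; simp
    _ ≤ m * ENNReal.ofReal L * (∫⁻ x, ‖U x‖ₑ) + ENNReal.ofReal L * ∫⁻ x, ‖U x‖ₑ := by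
        rw [← hAB]
        gcongr
        exact Measure.restrict_le_self
    _ = _ := by ring

end IsSolenoidalOnCube

/-! ### Interpolation estimate on one slice. -/

/-- Lets Hölder or Lipschitz bounds control the supremum of functions vanishing off the cube.
Pushing one coordinate to `0` requires `m > 0`. -/
theorem exists_notMem_openCube_norm_sub_le {m : ℕ} (hm : 0 < m) {x : Fin m → ℝ}
    (hx : x ∈ openCube m) : ∃ y, y ∉ openCube m ∧ ‖x - y‖ ≤ 1 := by
  let j : Fin m := ⟨0, hm⟩
  refine ⟨Function.update x j 0, fun h => ?_, ?_⟩
  · have := (mem_openCube.mp h j).1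
    simp at this
  · rw [pi_norm_le_iff_of_nonneg zero_le_one]
    intro k
    by_cases hk : k = j
    · subst hk
      have := mem_openCube.mp hx j
      simp only [Pi.sub_apply, Function.update_self, sub_zero, Real.norm_eq_abs]
      rw [abs_of_pos this.1]
      exact this.2.le
    · simp [Function.update_of_ne hk]

theorem lintegral_fderiv_rpow_lt_top {m : ℕ} {ψ : (Fin m → ℝ) → ℝ} (hψ : ContDiff ℝ 1 ψ)
    (hc : HasCompactSupport ψ) : ∫⁻ z, ‖fderiv ℝ ψ z‖ₑ ^ ((m : ℝ) + 1) ≠ ⊤ := by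
  have hcont : Continuous fun z => ‖fderiv ℝ ψ z‖ ^ ((m : ℝ) + 1) :=
    (hψ.continuous_fderiv one_ne_zero).norm.rpow_const fun _ => Or.inr (by positivity)
  have hi : Integrable fun z => ‖fderiv ℝ ψ z‖ ^ ((m : ℝ) + 1) := by
    refine hcont.integrable_of_hasCompactSupport ((hc.fderiv ℝ).comp_left (g := fun v =>
      ‖v‖ ^ ((m : ℝ) + 1)) ?_)
    rw [norm_zero, Real.zero_rpow (by positivity)]
  have h := hi.lintegral_lt_top.ne
  convert h using 3 with z
  rw [← ofReal_norm, ENNReal.ofReal_rpow_of_nonneg (norm_nonneg _) (by positivity)]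

/-- Hölder continuity of order `1 / (m + 1)`, with constant the `L^{m+1}` norm of the gradient. -/
theorem abs_sub_le_rpow_mul {m : ℕ} {ψ : (Fin m → ℝ) → ℝ} (hψ : ContDiff ℝ 1 ψ)
    (hc : HasCompactSupport ψ) (x y : Fin m → ℝ) :
    |ψ x - ψ y| ≤ (4 * (m + 1) *
      (∫⁻ z, ‖fderiv ℝ ψ z‖ₑ ^ ((m : ℝ) + 1)) ^ (1 / ((m : ℝ) + 1))).toReal *
        ‖x - y‖ ^ (1 / ((m : ℝ) + 1)) := by
  have hZ := lintegral_fderiv_rpow_lt_top hψ hc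
  have h := enorm_sub_le_rpow_mul_lintegral_fderiv hψ x y
  rw [← Real.norm_eq_abs, ← toReal_enorm]
  have h2 := ENNReal.toReal_mono (by
    refine ENNReal.mul_ne_top (ENNReal.mul_ne_top (by finiteness) ?_) ?_
    · exact ENNReal.rpow_ne_top_of_nonneg (by positivity) enorm_ne_top
    · exact ENNReal.rpow_ne_top_of_nonneg (by positivity) hZ) h
  refine h2.trans (le_of_eq ?_)
  simp only [ENNReal.toReal_mul, ← ENNReal.toReal_rpow, toReal_enorm]
  ring

namespace IsSolenoidalOnCube

/-- The interpolation estimate for the flux of a divergence free field through a slice. -/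
theorem exists_enorm_integral_slice_le {m : ℕ} (hm : 0 < m) :
    ∃ C : ℝ, 0 < C ∧ ∀ U : (Fin (m + 1) → ℝ) → (Fin (m + 1) → ℝ), IsSolenoidalOnCube U →
      ∫⁻ x, ‖U x‖ₑ ≠ 0 → ∫⁻ x, ‖U x‖ₑ ≠ ⊤ → ∀ (i : Fin (m + 1)) (ψ : (Fin m → ℝ) → ℝ),
      ContDiff ℝ 1 ψ → HasCompactSupport ψ → tsupport ψ ⊆ openCube m → ∀ t : ℝ,
      ‖∫ y, U (slicePoint i t y) i * ψ y‖ₑ ≤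
        ENNReal.ofReal C * (∫⁻ x, ‖U x‖ₑ) ^ (1 / ((m : ℝ) + 1)) *
          ((∫⁻ y, ‖U (slicePoint i t y)‖ₑ) ^ ((m : ℝ) / (m + 1)) *
            (∫⁻ z, ‖fderiv ℝ ψ z‖ₑ ^ ((m : ℝ) + 1)) ^ (1 / ((m : ℝ) + 1))) := by
  obtain ⟨C, hC, H⟩ := exists_contDiff_approx_of_oscillation m
  refine ⟨(3 + (m + 1) * C) * (4 * (m + 1)), by positivity,
    fun U hU hB0 hBt i ψ hψ hc hψs t => ?_⟩
  by_cases ht : t ∈ Set.Ioo (0 : ℝ) 1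
  swap
  · have : ∀ y, U (slicePoint i t y) = 0 := fun y =>
      hU.eq_zero _ fun h => ht ((slicePoint_mem_openCube i).mp h).1
    simp [this]
  have hψ0 : ∀ x, x ∉ openCube m → ψ x = 0 := fun x hx =>
    image_eq_zero_of_notMem_tsupport fun h => hx (hψs h)
  set Z := (∫⁻ z, ‖fderiv ℝ ψ z‖ₑ ^ ((m : ℝ) + 1)) ^ (1 / ((m : ℝ) + 1)) with hZ
  have hZt : Z ≠ ⊤ := ENNReal.rpow_ne_top_of_nonneg (by positivity)
    (lintegral_fderiv_rpow_lt_top hψ hc)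
  set A := ∫⁻ y, ‖U (slicePoint i t y)‖ₑ with hA
  set B := ∫⁻ x, ‖U x‖ₑ with hB
  have hAt : A ≠ ⊤ := by
    obtain ⟨M, hM⟩ := hU.exists_lintegral_slice_le i
    exact ((hM t).trans_lt ENNReal.ofReal_lt_top).ne
  set K := (4 * (m + 1) * Z).toReal with hK
  have hhold : ∀ x y, |ψ x - ψ y| ≤ K * ‖x - y‖ ^ (1 / ((m : ℝ) + 1)) :=
    abs_sub_le_rpow_mul hψ hc
  have hK0 : 0 ≤ K := ENNReal.toReal_nonneg
  have hsup : ∀ x, |ψ x| ≤ K := by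
    intro x
    by_cases hx : x ∈ openCube m
    · obtain ⟨y, hy, hxy⟩ := exists_notMem_openCube_norm_sub_le hm hx
      have h1 := hhold x y
      rw [hψ0 y hy, sub_zero] at h1
      exact h1.trans (mul_le_of_le_one_right hK0
        (Real.rpow_le_one (norm_nonneg _) hxy (by positivity)))
    · rw [hψ0 x hx, abs_zero]; exact hK0
  rcases hK0.eq_or_lt with hKz | hKpos
  · have : ∀ x, ψ x = 0 := fun x => abs_nonpos_iff.mp (hKz ▸ hsup x)
    simp [this]
  by_cases hA0 : A = 0
  · have h1 := enorm_integral_slice_mul_le (U := U) i i hsup t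
    rw [← hA, hA0, mul_zero] at h1
    exact h1.trans zero_le
  set a := A.toReal with ha
  set b := B.toReal with hb
  have ha0 : 0 < a := ENNReal.toReal_pos hA0 hAt
  have hb0 : 0 < b := ENNReal.toReal_pos hB0 hBt
  -- This scale makes `δ a` and `(δ / ε) b` equal. The cases `K = 0` and `A = 0` were removed so
  -- that `δ` and `ε` are positive.
  set ε := b / a with hε
  have hε0 : 0 < ε := by positivity
  set δ := K * ε ^ (1 / ((m : ℝ) + 1)) with hδ
  have hδ0 : 0 < δ := by positivity
  obtain ⟨g, hg, hgc, hgs, hgd, hgψ⟩ := H (openCube m) ψ δ ε (isBounded_openCube m)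
    hψ.continuous hψ0 hδ0 hε0 (fun x y hxy => (hhold x y).trans (by
      rw [hδ]
      gcongr))
  have hL0 : 0 ≤ C * δ / ε := by positivity
  -- `g` vanishes at some point at distance at most `1`, so its gradient bound also bounds its
  -- values.
  have hgsup : ∀ x, |g x| ≤ C * δ / ε := by
    intro x
    by_cases hx : x ∈ openCube m
    · obtain ⟨y, hy, hxy⟩ := exists_notMem_openCube_norm_sub_le hm hx
      have hgy : g y = 0 := image_eq_zero_of_notMem_tsupport fun h => hy (hgs h)
      have h1 := convex_univ.norm_image_sub_le_of_norm_fderiv_le (𝕜 := ℝ) (f := g)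
        (fun z _ => hg.differentiable one_ne_zero z) (fun z _ => hgd z) (Set.mem_univ y)
        (Set.mem_univ x)
      rw [hgy, sub_zero, Real.norm_eq_abs] at h1
      exact h1.trans (mul_le_of_le_one_right hL0 hxy)
    · rw [image_eq_zero_of_notMem_tsupport fun h => hx (hgs h), abs_zero]; exact hL0
  have hint : ∀ f : (Fin m → ℝ) → ℝ, ContDiff ℝ 1 f → HasCompactSupport f →
      tsupport f ⊆ openCube m → Integrable fun y => U (slicePoint i t y) i * f y :=
    fun f hf hfc hfs => (continuousOn_slice (hU.continuousOn_apply i) i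
      ht).integrable_mul_of_tsupport_subset (isOpen_openCube m) hf.continuous hfc hfs
  have hsplit : ∫ y, U (slicePoint i t y) i * ψ y =
      (∫ y, U (slicePoint i t y) i * (ψ y - g y)) + ∫ y, U (slicePoint i t y) i * g y := by
    rw [← integral_add]
    · congr 1; ext y; ring
    · simp only [mul_sub]
      exact (hint ψ hψ hc hψs).sub (hint g hg hgc hgs)
    · exact hint g hg hgc hgs
  have h1 := enorm_integral_slice_mul_le (U := U) i i (ψ := fun y => ψ y - g y)
    (fun y => by rw [abs_sub_comm]; exact hgψ y) t
  have h2 := hU.enorm_integral_slice_le i hg hgc hgs hgsup hgd ht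
  have h3 : ‖∫ y, U (slicePoint i t y) i * ψ y‖ₑ ≤
      ENNReal.ofReal (3 * δ) * A + (m + 1) * ENNReal.ofReal (C * δ / ε) * B := by
    rw [hsplit]
    exact (enorm_add_le _ _).trans (add_le_add h1 h2)
  refine h3.trans (le_of_eq ?_)
  have hbe : b = ε * a := by rw [hε]; field_simp
  have hm1 : (0:ℝ) < m + 1 := by positivity
  have hn : (m : ℝ≥0∞) + 1 = ENNReal.ofReal ((m : ℝ) + 1) := by
    rw [ENNReal.ofReal_add (by positivity) zero_le_one]; simp
  have hKZ : K = 4 * (m + 1) * Z.toReal := by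
    rw [hK, hn]; simp only [ENNReal.toReal_mul, ENNReal.toReal_ofReal hm1.le]; simp
  rw [← ENNReal.ofReal_toReal hAt, ← ENNReal.ofReal_toReal hBt, ← ENNReal.ofReal_toReal hZt,
    hn, ← ha, ← hb, ENNReal.ofReal_rpow_of_pos ha0, ENNReal.ofReal_rpow_of_pos hb0,
    ← ENNReal.ofReal_mul (by positivity), ← ENNReal.ofReal_mul (by positivity),
    ← ENNReal.ofReal_mul (by positivity), ← ENNReal.ofReal_add (by positivity) (by positivity),
    ← ENNReal.ofReal_mul (by positivity), ← ENNReal.ofReal_mul (by positivity),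
    ← ENNReal.ofReal_mul (by positivity)]
  congr 1
  have ha1 : a = a ^ (1 / ((m : ℝ) + 1)) * a ^ ((m : ℝ) / (m + 1)) := by
    rw [← Real.rpow_add ha0]
    nth_rewrite 1 [← Real.rpow_one a]
    congr 1
    field_simp
    ring
  have hb1 : b ^ (1 / ((m : ℝ) + 1)) = ε ^ (1 / ((m : ℝ) + 1)) * a ^ (1 / ((m : ℝ) + 1)) := by
    rw [hbe, Real.mul_rpow hε0.le ha0.le]
  have e1 : 3 * δ * a + (m + 1) * (C * δ / ε) * b = (3 + (m + 1) * C) * δ * a := by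
    rw [hbe]; field_simp
  rw [e1, hb1, hδ, hKZ]
  nth_rewrite 1 [ha1]
  ring

end IsSolenoidalOnCube

/-! ### Integration of the slice estimate. -/

section slice

variable {m : ℕ} (i : Fin (m + 1))

theorem contDiff_slicePoint (t : ℝ) : ContDiff ℝ 1 (slicePoint i t) := by
  rw [contDiff_pi, Fin.forall_iff_succAbove i]
  simp only [slicePoint_same, slicePoint_succAbove]
  exact ⟨contDiff_const, fun k => contDiff_apply ℝ ℝ k⟩

theorem lipschitzWith_slicePoint (t : ℝ) : LipschitzWith 1 (slicePoint i t) := by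
  refine LipschitzWith.of_dist_le_mul fun y z => ?_
  rw [slicePoint, slicePoint, Fin.dist_insertNth_insertNth]
  simp

/-- The inclusion of a slice is 1-Lipschitz for the sup norms, so restriction does not increase the
operator norm of the derivative. -/
theorem enorm_fderiv_comp_slicePoint_le {ψ : (Fin (m + 1) → ℝ) → ℝ} (hψ : ContDiff ℝ 1 ψ) (t : ℝ)
    (y : Fin m → ℝ) :
    ‖fderiv ℝ (fun y => ψ (slicePoint i t y)) y‖ₑ ≤ ‖fderiv ℝ ψ (slicePoint i t y)‖ₑ := by
  have h : fderiv ℝ (fun y => ψ (slicePoint i t y)) y =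
      (fderiv ℝ ψ (slicePoint i t y)).comp (fderiv ℝ (slicePoint i t) y) :=
    fderiv_comp y (hψ.differentiable one_ne_zero _)
      ((contDiff_slicePoint i t).differentiable one_ne_zero y)
  have h1 := norm_fderiv_le_of_lipschitz ℝ (lipschitzWith_slicePoint i t) (x₀ := y)
  rw [← ofReal_norm, ← ofReal_norm, h]
  refine ENNReal.ofReal_le_ofReal ((ContinuousLinearMap.opNorm_comp_le _ _).trans ?_)
  exact mul_le_of_le_one_right (norm_nonneg _) (by simpa using h1)

theorem tsupport_comp_slicePoint_subset {ψ : (Fin (m + 1) → ℝ) → ℝ}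
    (hψs : tsupport ψ ⊆ openCube (m + 1)) (t : ℝ) :
    tsupport (fun y => ψ (slicePoint i t y)) ⊆ openCube m := by
  have h1 : tsupport (fun y => ψ (slicePoint i t y)) ⊆ slicePoint i t ⁻¹' tsupport ψ :=
    tsupport_comp_subset_preimage ψ (contDiff_slicePoint i t).continuous
  exact fun y hy => ((slicePoint_mem_openCube i).mp (hψs (h1 hy))).2

end slice

namespace IsSolenoidalOnCube

theorem lintegral_ne_top {n : ℕ} {U : (Fin n → ℝ) → (Fin n → ℝ)} (hU : IsSolenoidalOnCube U) :
    ∫⁻ x, ‖U x‖ₑ ≠ ⊤ := by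
  obtain ⟨M, hM⟩ := hU.bounded
  refine ne_top_of_le_ne_top (b := ENNReal.ofReal M) ENNReal.ofReal_ne_top ?_
  calc ∫⁻ x, ‖U x‖ₑ ≤ ∫⁻ x, (openCube n).indicator (fun _ => ENNReal.ofReal M) x := by
        refine lintegral_mono fun x => ?_
        by_cases hx : x ∈ openCube n
        · rw [Set.indicator_of_mem hx, ← ofReal_norm]
          exact ENNReal.ofReal_le_ofReal (hM _)
        · rw [hU.eq_zero _ hx]
          simp
    _ = _ := by
        rw [lintegral_indicator (isOpen_openCube n).measurableSet]
        simp [volume_openCube]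

/-- Hölder in `t` with weights `m/(m+1)` and `1/(m+1)`, then Fubini, turns the slice quantities into
`B^{m/(m+1)}` and the full gradient norm; the prefactor `B^{1/(m+1)}` completes `B`. -/
theorem exists_enorm_integral_apply_mul_le {m : ℕ} (hm : 0 < m) :
    ∃ C : ℝ, 0 < C ∧ ∀ U : (Fin (m + 1) → ℝ) → (Fin (m + 1) → ℝ), IsSolenoidalOnCube U →
      ∀ (i : Fin (m + 1)) (ψ : (Fin (m + 1) → ℝ) → ℝ),
      ContDiff ℝ 1 ψ → HasCompactSupport ψ → tsupport ψ ⊆ openCube (m + 1) →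
      ‖∫ x, U x i * ψ x‖ₑ ≤ ENNReal.ofReal C * (∫⁻ x, ‖U x‖ₑ) *
        (∫⁻ x, ‖fderiv ℝ ψ x‖ₑ ^ ((m : ℝ) + 1)) ^ (1 / ((m : ℝ) + 1)) := by
  obtain ⟨C, hC, H⟩ := exists_enorm_integral_slice_le hm
  refine ⟨C, hC, fun U hU i ψ hψ hc hψs => ?_⟩
  have hm1 : (0:ℝ) < m + 1 := by positivity
  by_cases hB0 : ∫⁻ x, ‖U x‖ₑ = 0
  · have h0 : ∀ᵐ x, U x i * ψ x = 0 := by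
      rw [lintegral_eq_zero_iff hU.measurable.enorm] at hB0
      filter_upwards [hB0] with x hx
      have : U x = 0 := by simpa using hx
      simp [this]
    rw [integral_eq_zero_of_ae h0]
    simp
  have hBt := hU.lintegral_ne_top
  have hint : Integrable fun x => U x i * ψ x :=
    (hU.continuousOn_apply i).integrable_mul_of_tsupport_subset (isOpen_openCube _)
      hψ.continuous hc hψs
  have hAm : Measurable fun t => ∫⁻ y, ‖U (slicePoint i t y)‖ₑ :=
    (hU.measurable.comp (continuous_slicePoint i).measurable).enorm.lintegral_prod_right'
  have hdc : Continuous (fderiv ℝ ψ) := hψ.continuous_fderiv one_ne_zero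
  have hZm : Measurable fun x => ‖fderiv ℝ ψ x‖ₑ ^ ((m : ℝ) + 1) :=
    hdc.enorm.measurable.pow_const _
  have hZm' : Measurable fun t => ∫⁻ y, ‖fderiv ℝ ψ (slicePoint i t y)‖ₑ ^ ((m : ℝ) + 1) :=
    (hZm.comp (continuous_slicePoint i).measurable).lintegral_prod_right'
  rw [← integral_slicePoint i hint]
  set B := ∫⁻ x, ‖U x‖ₑ with hB
  calc ‖∫ t, ∫ y, U (slicePoint i t y) i * ψ (slicePoint i t y)‖ₑ
      ≤ ∫⁻ t, ‖∫ y, U (slicePoint i t y) i * ψ (slicePoint i t y)‖ₑ :=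
        enorm_integral_le_lintegral_enorm _
    _ ≤ ∫⁻ t, ENNReal.ofReal C * B ^ (1 / ((m : ℝ) + 1)) *
          ((∫⁻ y, ‖U (slicePoint i t y)‖ₑ) ^ ((m : ℝ) / (m + 1)) *
            (∫⁻ y, ‖fderiv ℝ ψ (slicePoint i t y)‖ₑ ^ ((m : ℝ) + 1)) ^ (1 / ((m : ℝ) + 1))) := by
        refine lintegral_mono fun t => ?_
        have hts := tsupport_comp_slicePoint_subset i hψs t
        refine (H U hU hB0 hBt i (fun y => ψ (slicePoint i t y))
          (hψ.comp (contDiff_slicePoint i t))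
          (Metric.isCompact_of_isClosed_isBounded (isClosed_tsupport _)
            ((isBounded_openCube m).subset hts)) hts t).trans ?_
        gcongr with y
        exact enorm_fderiv_comp_slicePoint_le i hψ t y
    _ = ENNReal.ofReal C * B ^ (1 / ((m : ℝ) + 1)) * ∫⁻ t,
          ((∫⁻ y, ‖U (slicePoint i t y)‖ₑ) ^ ((m : ℝ) / (m + 1)) *
            (∫⁻ y, ‖fderiv ℝ ψ (slicePoint i t y)‖ₑ ^ ((m : ℝ) + 1)) ^ (1 / ((m : ℝ) + 1))) :=
        lintegral_const_mul' _ _ (ENNReal.mul_ne_top ENNReal.ofReal_ne_top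
          (ENNReal.rpow_ne_top_of_nonneg (by positivity) hBt))
    _ ≤ ENNReal.ofReal C * B ^ (1 / ((m : ℝ) + 1)) *
          (B ^ ((m : ℝ) / (m + 1)) *
            (∫⁻ x, ‖fderiv ℝ ψ x‖ₑ ^ ((m : ℝ) + 1)) ^ (1 / ((m : ℝ) + 1))) := by
        gcongr
        rw [hB, ← lintegral_slicePoint i hU.measurable.enorm, ← lintegral_slicePoint i hZm]
        exact ENNReal.lintegral_mul_norm_pow_le hAm.aemeasurable hZm'.aemeasurable (by positivity)
          (by positivity) (by field_simp)
    _ = ENNReal.ofReal C * (B ^ (1 / ((m : ℝ) + 1)) * B ^ ((m : ℝ) / (m + 1))) *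
            (∫⁻ x, ‖fderiv ℝ ψ x‖ₑ ^ ((m : ℝ) + 1)) ^ (1 / ((m : ℝ) + 1)) := by ring
    _ = _ := by
        rw [← ENNReal.rpow_add_of_nonneg _ _ (by positivity) (by positivity),
          show 1 / ((m : ℝ) + 1) + (m : ℝ) / (m + 1) = 1 by field_simp; ring, ENNReal.rpow_one]

end IsSolenoidalOnCube

/-! ### Dimension one, and the estimate in all dimensions. -/

theorem enorm_le_lintegral_fderiv_of_fin_one {ψ : (Fin 1 → ℝ) → ℝ} (hψ : ContDiff ℝ 1 ψ)
    (hc : HasCompactSupport ψ) (x : Fin 1 → ℝ) : ‖ψ x‖ₑ ≤ ∫⁻ z, ‖fderiv ℝ ψ z‖ₑ := by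
  set e : ℝ → (Fin 1 → ℝ) := fun s _ => s with he
  have hder : ∀ s, HasDerivAt e (fun _ => 1) s := fun s =>
    hasDerivAt_pi.mpr fun _ => hasDerivAt_id s
  have hcd : ContDiff ℝ 1 (ψ ∘ e) := hψ.comp (contDiff_pi.mpr fun _ => contDiff_id)
  have hemb : Topology.IsClosedEmbedding e := (Homeomorph.funUnique (Fin 1) ℝ).symm.isClosedEmbedding
  have hx : x = e (x 0) := by
    funext j
    rw [Subsingleton.elim j 0]
  have hmp := (volume_preserving_funUnique (Fin 1) ℝ).symm _
  have hlin : ∫⁻ s, ‖fderiv ℝ ψ (e s)‖ₑ = ∫⁻ z, ‖fderiv ℝ ψ z‖ₑ :=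
    hmp.lintegral_comp (hψ.continuous_fderiv one_ne_zero).enorm.measurable
  have h1 := (hc.comp_isClosedEmbedding hemb).enorm_le_lintegral_Ici_deriv hcd (x 0)
  calc ‖ψ x‖ₑ = ‖(ψ ∘ e) (x 0)‖ₑ := by rw [Function.comp_apply, ← hx]
    _ ≤ ∫⁻ s in Set.Iic (x 0), ‖deriv (ψ ∘ e) s‖ₑ := h1
    _ ≤ ∫⁻ s, ‖deriv (ψ ∘ e) s‖ₑ := setLIntegral_le_lintegral _ _
    _ ≤ ∫⁻ s, ‖fderiv ℝ ψ (e s)‖ₑ := by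
        refine lintegral_mono fun s => ?_
        rw [((hψ.differentiable one_ne_zero (e s)).hasFDerivAt.comp_hasDerivAt s (hder s)).deriv]
        rw [← ofReal_norm, ← ofReal_norm]
        refine ENNReal.ofReal_le_ofReal (((fderiv ℝ ψ (e s)).le_opNorm _).trans ?_)
        refine mul_le_of_le_one_right (norm_nonneg _) ?_
        rw [pi_norm_le_iff_of_nonneg zero_le_one]
        simp
    _ = _ := hlin

theorem exists_enorm_integral_apply_mul_le_lintegral_fderiv (m : ℕ) :
    ∃ C : ℝ, 0 < C ∧ ∀ U : (Fin (m + 1) → ℝ) → (Fin (m + 1) → ℝ), IsSolenoidalOnCube U →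
      ∀ (i : Fin (m + 1)) (ψ : (Fin (m + 1) → ℝ) → ℝ),
      ContDiff ℝ 1 ψ → HasCompactSupport ψ → tsupport ψ ⊆ openCube (m + 1) →
      ‖∫ x, U x i * ψ x‖ₑ ≤ ENNReal.ofReal C * (∫⁻ x, ‖U x‖ₑ) *
        (∫⁻ x, ‖fderiv ℝ ψ x‖ₑ ^ ((m : ℝ) + 1)) ^ (1 / ((m : ℝ) + 1)) := by
  rcases Nat.eq_zero_or_pos m with rfl | hm
  · refine ⟨1, one_pos, fun U hU i ψ hψ hc _ => ?_⟩
    simp only [Nat.cast_zero, zero_add, ENNReal.rpow_one, div_one, ENNReal.ofReal_one, one_mul]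
    refine (enorm_integral_le_lintegral_enorm _).trans ?_
    rw [← lintegral_mul_const _ hU.measurable.enorm]
    refine lintegral_mono fun x => ?_
    rw [enorm_mul]
    gcongr
    · rw [← ofReal_norm, ← ofReal_norm]; exact ENNReal.ofReal_le_ofReal (norm_le_pi_norm _ i)
    · exact enorm_le_lintegral_fderiv_of_fin_one hψ hc x
  · exact IsSolenoidalOnCube.exists_enorm_integral_apply_mul_le hm

/-! ### Transfer to Euclidean space. -/

section EuclideanSpace

variable {n : ℕ}

theorem toLp_mem_unitCube {x : Fin n → ℝ} : WithLp.toLp 2 x ∈ unitCube n ↔ x ∈ openCube n := by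
  rw [mem_openCube]; rfl

theorem toLp_preimage_unitCube : WithLp.toLp 2 ⁻¹' unitCube n = openCube n :=
  Set.ext fun _ => toLp_mem_unitCube

theorem isOpen_unitCube (n : ℕ) : IsOpen (unitCube n) := by
  have : unitCube n = WithLp.ofLp ⁻¹' openCube n := by
    ext x; rw [Set.mem_preimage, mem_openCube]; rfl
  rw [this]
  exact (isOpen_openCube n).preimage (PiLp.continuous_ofLp 2 _)

theorem measurePreserving_toLp (n : ℕ) :
    MeasurePreserving (MeasurableEquiv.toLp 2 (Fin n → ℝ)) volume volume :=
  (EuclideanSpace.volume_preserving_symm_measurableEquiv_toLp (Fin n)).symm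

theorem isBounded_unitCube (n : ℕ) : Bornology.IsBounded (unitCube n) := by
  have h := (PiLp.lipschitzWith_toLp 2 fun _ : Fin n => ℝ).isBounded_image (isBounded_openCube n)
  refine h.subset fun x hx => ⟨WithLp.ofLp x, ?_, rfl⟩
  exact mem_openCube.mpr hx

theorem isCompact_closure_unitCube (n : ℕ) : IsCompact (closure (unitCube n)) :=
  (isBounded_unitCube n).isCompact_closure

theorem memLp_unitCube {F : Type*} [NormedAddCommGroup F] {f : EuclideanSpace ℝ (Fin n) → F}
    (hf : ContinuousOn f (closure (unitCube n))) (p : ℝ≥0∞) :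
    MemLp f p (volume.restrict (unitCube n)) := by
  obtain ⟨M, hM⟩ := (isCompact_closure_unitCube n).exists_bound_of_continuousOn hf
  have : IsFiniteMeasure ((volume : Measure (EuclideanSpace ℝ (Fin n))).restrict (unitCube n)) :=
    ⟨by
      rw [Measure.restrict_apply_univ]
      exact (measure_mono subset_closure).trans_lt (isCompact_closure_unitCube n).measure_lt_top⟩
  have hm : MeasurableSet (unitCube n) := (isOpen_unitCube n).measurableSet
  refine MemLp.of_bound ?_ M ?_
  · exact (hf.mono subset_closure).aestronglyMeasurable hm
  · filter_upwards [ae_restrict_mem hm] with x hx using hM x (subset_closure hx)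

theorem setLIntegral_unitCube (f : EuclideanSpace ℝ (Fin n) → ℝ≥0∞) :
    ∫⁻ x in unitCube n, f x = ∫⁻ x in openCube n, f (WithLp.toLp 2 x) := by
  rw [← toLp_preimage_unitCube]
  exact ((measurePreserving_toLp n).setLIntegral_comp_preimage_emb
    (MeasurableEquiv.measurableEmbedding _) f _).symm

theorem setIntegral_unitCube (f : EuclideanSpace ℝ (Fin n) → ℝ) :
    ∫ x in unitCube n, f x = ∫ x in openCube n, f (WithLp.toLp 2 x) := by
  rw [← toLp_preimage_unitCube]
  exact ((measurePreserving_toLp n).setIntegral_preimage_emb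
    (MeasurableEquiv.measurableEmbedding _) f _).symm

/-- A field on the Euclidean unit cube, in product coordinates and extended by zero. -/
noncomputable def cubeExtension (Φ : EuclideanSpace ℝ (Fin n) → EuclideanSpace ℝ (Fin n)) :
    (Fin n → ℝ) → (Fin n → ℝ) :=
  (openCube n).indicator fun x => WithLp.ofLp (Φ (WithLp.toLp 2 x))

theorem hasFDerivAt_ofLp_comp_toLp {u : EuclideanSpace ℝ (Fin n) → EuclideanSpace ℝ (Fin n)}
    {x : Fin n → ℝ} (hu : DifferentiableAt ℝ u (WithLp.toLp 2 x)) :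
    HasFDerivAt (fun x => WithLp.ofLp (u (WithLp.toLp 2 x)))
      ((PiLp.continuousLinearEquiv 2 ℝ fun _ : Fin n => ℝ).toContinuousLinearMap.comp
        ((fderiv ℝ u (WithLp.toLp 2 x)).comp
          (PiLp.continuousLinearEquiv 2 ℝ fun _ : Fin n => ℝ).symm.toContinuousLinearMap)) x := by
  have h1 := (PiLp.continuousLinearEquiv 2 ℝ fun _ : Fin n => ℝ).symm.hasFDerivAt (x := x)
  have h2 := HasFDerivAt.comp x (g := u) hu.hasFDerivAt h1
  exact (PiLp.continuousLinearEquiv 2 ℝ fun _ : Fin n => ℝ).hasFDerivAt.comp x h2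

theorem isSolenoidalOnCube_cubeExtension
    {Φ : EuclideanSpace ℝ (Fin n) → EuclideanSpace ℝ (Fin n)}
    (hc : ContinuousOn Φ (closure (unitCube n))) (hd : ContDiffOn ℝ 1 Φ (unitCube n))
    (hdiv : ∀ x ∈ unitCube n, divergence Φ x = 0) : IsSolenoidalOnCube (cubeExtension Φ) where
  measurable := by
    classical
    have h : ContinuousOn (fun x : Fin n → ℝ => WithLp.ofLp (Φ (WithLp.toLp 2 x))) (openCube n) :=
      (PiLp.continuous_ofLp 2 _).comp_continuousOn
        (hd.continuousOn.comp (PiLp.continuous_toLp 2 _).continuousOn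
          fun x hx => toLp_mem_unitCube.mpr hx)
    rw [cubeExtension, ← Set.piecewise_eq_indicator]
    exact h.measurable_piecewise continuousOn_const (isOpen_openCube n).measurableSet
  eq_zero x hx := Set.indicator_of_notMem hx _
  bounded := by
    -- Continuity up to the boundary enters here, through compactness of the closed cube.
    obtain ⟨M, hM⟩ := (isCompact_closure_unitCube n).exists_bound_of_continuousOn hc
    refine ⟨max M 0, fun x => ?_⟩
    by_cases hx : x ∈ openCube n
    · rw [cubeExtension, Set.indicator_of_mem hx, pi_norm_le_iff_of_nonneg (le_max_right _ _)]
      exact fun i => (PiLp.norm_apply_le _ i).trans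
        ((hM _ (subset_closure (toLp_mem_unitCube.mpr hx))).trans (le_max_left _ _))
    · rw [cubeExtension, Set.indicator_of_notMem hx, norm_zero]
      exact le_max_right _ _
  contDiffOn := by
    have h : ContDiffOn ℝ 1 (fun x : Fin n → ℝ => WithLp.ofLp (Φ (WithLp.toLp 2 x)))
        (openCube n) :=
      (PiLp.continuousLinearEquiv 2 ℝ fun _ : Fin n => ℝ).contDiff.comp_contDiffOn
        (hd.comp (PiLp.continuousLinearEquiv 2 ℝ fun _ : Fin n => ℝ).symm.contDiff.contDiffOn
          fun x hx => toLp_mem_unitCube.mpr hx)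
    exact h.congr fun x hx => Set.indicator_of_mem hx _
  div_eq_zero x hx := by
    have hx' := toLp_mem_unitCube.mpr hx
    have hdiff := (hd.differentiableOn one_ne_zero).differentiableAt
      ((isOpen_unitCube n).mem_nhds hx')
    have hev : cubeExtension Φ =ᶠ[nhds x] fun x => WithLp.ofLp (Φ (WithLp.toLp 2 x)) := by
      filter_upwards [(isOpen_openCube n).mem_nhds hx] with y hy
      exact Set.indicator_of_mem hy _
    rw [hev.fderiv_eq, (hasFDerivAt_ofLp_comp_toLp hdiff).fderiv]
    -- After the chain rule the two divergences agree definitionally.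
    exact hdiv _ hx'

theorem lintegral_cubeExtension_le (Φ : EuclideanSpace ℝ (Fin n) → EuclideanSpace ℝ (Fin n)) :
    ∫⁻ x, ‖cubeExtension Φ x‖ₑ ≤ eLpNorm Φ 1 (volume.restrict (unitCube n)) := by
  rw [eLpNorm_one_eq_lintegral_enorm, setLIntegral_unitCube,
    ← lintegral_indicator (isOpen_openCube n).measurableSet]
  refine lintegral_mono fun x => ?_
  by_cases hx : x ∈ openCube n
  · simp only [cubeExtension, Set.indicator_of_mem hx]
    rw [← ofReal_norm, ← ofReal_norm]
    refine ENNReal.ofReal_le_ofReal ((pi_norm_le_iff_of_nonneg (norm_nonneg _)).mpr fun i => ?_)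
    exact PiLp.norm_apply_le _ i
  · simp [cubeExtension, hx]

theorem setIntegral_inner_eq_sum {Φ φ : EuclideanSpace ℝ (Fin n) → EuclideanSpace ℝ (Fin n)}
    (hint : ∀ i, Integrable fun x => cubeExtension Φ x i * φ (WithLp.toLp 2 x) i) :
    ∫ x in unitCube n, inner ℝ (Φ x) (φ x) =
      ∑ i, ∫ x, cubeExtension Φ x i * φ (WithLp.toLp 2 x) i := by
  rw [setIntegral_unitCube, ← integral_finsetSum _ fun i _ => hint i,
    ← integral_indicator (isOpen_openCube n).measurableSet]
  congr 1
  ext x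
  by_cases hx : x ∈ openCube n
  · simp only [cubeExtension, Set.indicator_of_mem hx, PiLp.inner_apply]
    refine Finset.sum_congr rfl fun i _ => ?_
    simp [mul_comm]
  · simp [cubeExtension, hx]

/-- The norm dual to the sup norm is the sum of the `|T e_j|`; this is the source of the factor `n`
against the Frobenius norm. -/
theorem opNorm_le_card_mul_of_apply_single_le (T : (Fin n → ℝ) →L[ℝ] ℝ) {M : ℝ} (hM : 0 ≤ M)
    (h : ∀ j, ‖T (Pi.single j 1)‖ ≤ M) : ‖T‖ ≤ n * M := by
  refine T.opNorm_le_bound (by positivity) fun v => ?_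
  have hv : T v = ∑ j, v j * T (Pi.single j 1) := by
    conv_lhs => rw [pi_eq_sum_univ' v]
    simp [map_sum]
  rw [hv]
  refine (norm_sum_le _ _).trans ?_
  calc ∑ j, ‖v j * T (Pi.single j 1)‖ ≤ ∑ _j : Fin n, ‖v‖ * M := by
        refine Finset.sum_le_sum fun j _ => ?_
        rw [norm_mul]
        exact mul_le_mul (norm_le_pi_norm v j) (h j) (norm_nonneg _) (norm_nonneg _)
    _ = _ := by
        rw [Finset.sum_const, Finset.card_univ, Fintype.card_fin, nsmul_eq_mul]; ring

theorem norm_fderiv_apply_le_gradMatrix {φ : EuclideanSpace ℝ (Fin n) → EuclideanSpace ℝ (Fin n)}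
    (hφ : Differentiable ℝ φ) (i : Fin n) (x : Fin n → ℝ) :
    ‖fderiv ℝ (fun x => φ (WithLp.toLp 2 x) i) x‖ ≤ n * ‖gradMatrix φ (WithLp.toLp 2 x)‖ := by
  have h1 : HasFDerivAt (fun x => φ (WithLp.toLp 2 x) i) _ x :=
    (ContinuousLinearMap.proj (R := ℝ) (φ := fun _ : Fin n => ℝ) i).hasFDerivAt.comp x
      (hasFDerivAt_ofLp_comp_toLp (hφ (WithLp.toLp 2 x)))
  rw [h1.fderiv]
  refine opNorm_le_card_mul_of_apply_single_le _ (norm_nonneg _) fun j => ?_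
  exact PiLp.norm_apply_le (gradMatrix φ (WithLp.toLp 2 x)) (i, j)

theorem continuous_gradMatrix {φ : EuclideanSpace ℝ (Fin n) → EuclideanSpace ℝ (Fin n)}
    (hφ : ContDiff ℝ 1 φ) : Continuous (gradMatrix φ) := by
  refine (PiLp.continuous_toLp 2 _).comp (continuous_pi fun p => ?_)
  exact (PiLp.continuous_apply 2 _ p.1).comp
    ((hφ.continuous_fderiv one_ne_zero).clm_apply continuous_const)

theorem tsupport_toLp_apply_subset {φ : EuclideanSpace ℝ (Fin n) → EuclideanSpace ℝ (Fin n)}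
    (hφ : tsupport φ ⊆ unitCube n) (i : Fin n) :
    tsupport (fun x : Fin n → ℝ => φ (WithLp.toLp 2 x) i) ⊆ openCube n := by
  have h1 : tsupport (fun x : Fin n → ℝ => φ (WithLp.toLp 2 x) i) ⊆
      WithLp.toLp 2 ⁻¹' tsupport φ := by
    refine closure_minimal (fun x hx => subset_tsupport φ ?_)
      ((isClosed_tsupport φ).preimage (PiLp.continuous_toLp 2 _))
    intro h0
    apply hx
    simp [h0]
  exact fun x hx => toLp_mem_unitCube.mp (hφ (h1 hx))

theorem lintegral_fderiv_apply_le {φ : EuclideanSpace ℝ (Fin n) → EuclideanSpace ℝ (Fin n)}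
    (hn : n ≠ 0) (hφ : ContDiff ℝ 1 φ) (hs : tsupport φ ⊆ unitCube n) (i : Fin n) :
    (∫⁻ x, ‖fderiv ℝ (fun x => φ (WithLp.toLp 2 x) i) x‖ₑ ^ (n : ℝ)) ^ (1 / (n : ℝ)) ≤
      n * eLpNorm (gradMatrix φ) n (volume.restrict (unitCube n)) := by
  have hn0 : (0:ℝ) < n := by positivity
  rw [eLpNorm_eq_lintegral_rpow_enorm_toReal (by simpa using hn) (by simp), setLIntegral_unitCube]
  simp only [ENNReal.toReal_natCast]
  have hnn : (n : ℝ≥0∞) = ((n : ℝ≥0∞) ^ (n : ℝ)) ^ (1 / (n : ℝ)) := by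
    rw [← ENNReal.rpow_mul, mul_one_div_cancel hn0.ne', ENNReal.rpow_one]
  conv_rhs => rw [hnn]
  rw [← ENNReal.mul_rpow_of_nonneg _ _ (by positivity),
    ← lintegral_const_mul' _ _ (by finiteness),
    ← lintegral_indicator (isOpen_openCube n).measurableSet]
  gcongr with x
  by_cases hx : x ∈ openCube n
  · rw [Set.indicator_of_mem hx, ← ENNReal.mul_rpow_of_nonneg _ _ (by positivity)]
    gcongr
    rw [← ofReal_norm, ← ofReal_norm, ← ENNReal.ofReal_natCast,
      ← ENNReal.ofReal_mul (by positivity)]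
    exact ENNReal.ofReal_le_ofReal
      (norm_fderiv_apply_le_gradMatrix (hφ.differentiable one_ne_zero) i x)
  -- Off the cube the derivative vanishes, so the integral over the whole space reduces to the cube.
  · have : fderiv ℝ (fun x => φ (WithLp.toLp 2 x) i) x = 0 := by
      by_contra hne
      exact hx (tsupport_toLp_apply_subset hs i
        (support_fderiv_subset ℝ (Function.mem_support.mpr hne)))
    rw [this, ← ofReal_norm, norm_zero, ENNReal.ofReal_zero, ENNReal.zero_rpow_of_pos hn0]
    exact zero_le

end EuclideanSpace

end

/-! ### Conclusion. -/

theorem proposition3p2 (n : ℕ) (hn : 1 ≤ n) :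
    ∃ c : ℝ, 0 < c ∧
      ∀ Φ φ : EuclideanSpace ℝ (Fin n) → EuclideanSpace ℝ (Fin n),
        ContinuousOn Φ (closure (unitCube n)) →
        ContDiffOn ℝ 1 Φ (unitCube n) →
        (∀ x ∈ unitCube n, divergence Φ x = 0) →
        ContDiff ℝ ∞ φ →
        HasCompactSupport φ →
        tsupport φ ⊆ unitCube n →
        ∫ x in unitCube n, inner ℝ (Φ x) (φ x) ≤
          c * lpNorm Φ 1 (volume.restrict (unitCube n)) *
            lpNorm (gradMatrix φ) n (volume.restrict (unitCube n)) := by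
  obtain ⟨m, rfl⟩ : ∃ m, n = m + 1 := ⟨n - 1, by omega⟩
  obtain ⟨C, hC, H⟩ := exists_enorm_integral_apply_mul_le_lintegral_fderiv m
  -- One factor `m + 1` counts the components of the field; the other compares the operator norm
  -- with the Frobenius norm.
  refine ⟨(m + 1) * (C * (m + 1)), by positivity, fun Φ φ hΦc hΦd hdiv hφ _ hφs => ?_⟩
  have hφ1 : ContDiff ℝ 1 φ := hφ.of_le (by exact_mod_cast le_top)
  have hU := isSolenoidalOnCube_cubeExtension hΦc hΦd hdiv
  have hψ : ∀ i, ContDiff ℝ 1 fun x : Fin (m + 1) → ℝ => φ (WithLp.toLp 2 x) i := fun i =>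
    (ContinuousLinearMap.proj (R := ℝ) (φ := fun _ : Fin (m + 1) => ℝ) i).contDiff.comp
      ((PiLp.continuousLinearEquiv 2 ℝ fun _ : Fin (m + 1) => ℝ).contDiff.comp
        (hφ1.comp (PiLp.continuousLinearEquiv 2 ℝ fun _ : Fin (m + 1) => ℝ).symm.contDiff))
  have hψs := fun i => tsupport_toLp_apply_subset hφs i
  have hψc : ∀ i, HasCompactSupport fun x : Fin (m + 1) → ℝ => φ (WithLp.toLp 2 x) i := fun i =>
    Metric.isCompact_of_isClosed_isBounded (isClosed_tsupport _)
      ((isBounded_openCube _).subset (hψs i))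
  -- Both norms are finite, so the extended inequality passes to real numbers through `toReal`.
  have hΦL := memLp_unitCube hΦc 1
  have hφL := memLp_unitCube (continuous_gradMatrix hφ1).continuousOn ((m + 1 : ℕ) : ENNReal)
  rw [setIntegral_inner_eq_sum fun i => (hU.continuousOn_apply i).integrable_mul_of_tsupport_subset
    (isOpen_openCube _) (hψ i).continuous (hψc i) (hψs i),
    ← toReal_eLpNorm hΦL.aestronglyMeasurable, ← toReal_eLpNorm hφL.aestronglyMeasurable]
  set a := eLpNorm Φ 1 (volume.restrict (unitCube (m + 1))) with ha
  set b := eLpNorm (gradMatrix φ) ((m + 1 : ℕ) : ENNReal) (volume.restrict (unitCube (m + 1))) with hb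
  have hat : a ≠ ⊤ := hΦL.eLpNorm_ne_top
  have hbt : b ≠ ⊤ := hφL.eLpNorm_ne_top
  have hterm : ∀ i, ∫ x, cubeExtension Φ x i * φ (WithLp.toLp 2 x) i ≤
      C * (m + 1) * a.toReal * b.toReal := by
    intro i
    have h1 := H _ hU i _ (hψ i) (hψc i) (hψs i)
    have h2 := lintegral_fderiv_apply_le (n := m + 1) m.succ_ne_zero hφ1 hφs i
    rw [← hb, Nat.cast_succ (R := ℝ)] at h2
    have h3 : ‖∫ x, cubeExtension Φ x i * φ (WithLp.toLp 2 x) i‖ₑ ≤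
        ENNReal.ofReal C * a * (((m + 1 : ℕ) : ENNReal) * b) := by
      refine h1.trans ?_
      gcongr
      · exact lintegral_cubeExtension_le Φ
    clear_value a b
    have h4 := ENNReal.toReal_mono (ENNReal.mul_ne_top
      (ENNReal.mul_ne_top ENNReal.ofReal_ne_top hat)
      (ENNReal.mul_ne_top (ENNReal.natCast_ne_top _) hbt)) h3
    rw [toReal_enorm] at h4
    simp only [ENNReal.toReal_mul, ENNReal.toReal_ofReal hC.le, ENNReal.toReal_natCast] at h4
    push_cast at h4
    refine (Real.le_norm_self _).trans (h4.trans (le_of_eq ?_))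
    ring
  refine (Finset.sum_le_sum fun i _ => hterm i).trans (le_of_eq ?_)
  rw [Finset.sum_const, Finset.card_univ, Fintype.card_fin, nsmul_eq_mul]
  push_cast
  ring
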